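/- Let $X$ be a complex manifold (Hausdorff, second countable, finite-dimensional, not necessarily connected). All forms are smooth. For a real closed one-form $\alpha$ on $X$ write $\alpha=\alpha_{1,0}+\alpha_{0,1}$ for its decomposition into types; then $\overline\partial\alpha_{1,0}$ and $\alpha_{1,0}\wedge\alpha_{0,1}$ induce Hermitian forms $(L,M)\mapsto \overline\partial\alpha_{1,0}(L,\overline M)$ and $(L,M)\mapsto(\alpha_{1,0}\wedge\alpha_{0,1})(L,\overline M)$ on $T^{1,0}X$. Put $$\mathfrak n_{X,0}(\alpha):=\inf\{\lambda>0 : \alpha_{1,0}\wedge\alpha_{0,1}\le\lambda\,\overline\partial\alpha_{1,0}\}\in[0,+\infty],$$ where the inequality is in the sense of Hermitian forms on $T^{1,0}X$ and $\inf\emptyset=+\infty$. For a class $[\alpha]\in H^1_{\mathrm{dR}}(X,\mathbb R)$ put $$\mathfrak n_X([\alpha]):=\inf\{\mathfrak n_{X,0}(\beta): \beta \text{ a real closed one-form},\ [\beta]=[\alpha]\}=\inf\{\mathfrak n_{X,0}(\alpha+df): f\in C^\infty(X,\mathbb R)\}.$$ Then $\mathfrak n_X:H^1_{\mathrm{dR}}(X,\mathbb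 R)\to[0,+\infty]$ has the following properties. i) Non-degeneracy: $\mathfrak n_X([\alpha])=0$ if and only if $[\alpha]=0$. ii) Homogeneity: $\mathfrak n_X(t[\alpha])=t\,\mathfrak n_X([\alpha])$ for every real $t\ge0$ and every $[\alpha]\in H^1_{\mathrm{dR}}(X,\mathbb R)$, with the convention $0\cdot\infty=0$. iii) Quasi-triangle inequality: $\mathfrak n_X([\alpha]+[\beta])\le2\max\{\mathfrak n_X([\alpha]),\mathfrak n_X([\beta])\}$ for all $[\alpha],[\beta]\in H^1_{\mathrm{dR}}(X,\mathbb R)$. Moreover, if $Y$ is another complex manifold and $F:Y\to X$ is holomorphic, then the induced map $F^*:H^1_{\mathrm{dR}}(X,\mathbb R)\to H^1_{\mathrm{dR}}(Y,\mathbb R)$ satisfies $\mathfrak n_Y(F^*[\alpha])\le\mathfrak n_X([\alpha])$ for every $[\alpha]\in H^1_{\mathrm{dR}}(X,\mathbb R)$. -/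

import Mathlib

open scoped Manifold ContDiff

noncomputable section

namespace HolNorm

section Forms

variable (E : Type*) [NormedAddCommGroup E] [NormedSpace ℝ E]
  (X : Type*) [TopologicalSpace X] [ChartedSpace E X]

/-- (Not necessarily smooth) `F`-valued differential `k`-forms on a real manifold `X` modelled on
the vector space `E`. -/
abbrev Form (k : ℕ) (F : Type*) [NormedAddCommGroup F] [NormedSpace ℝ F] :=
  (x : X) → TangentSpace 𝓘(ℝ, E) x [⋀^Fin k]→L[ℝ] F

theorem two_le : minSmoothness ℝ 2 ≤ ∞ := by
  rw [minSmoothness_of_isRCLikeNormedField]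
  exact WithTop.coe_le_coe.2 (le_top : (2 : ℕ∞) ≤ ⊤)

variable {E X} {F : Type*} [NormedAddCommGroup F] [NormedSpace ℝ F] {k : ℕ}

/-- The form `α` read in the preferred chart `φ` at `x₀`, i.e. the pullback `(φ⁻¹)^* α`. It is
meaningful on the open set `φ.target`. -/
def Form.inChart (α : Form E X k F) (x₀ : X) : E → E [⋀^Fin k]→L[ℝ] F := fun y =>
  (α ((chartAt E x₀).symm y)).compContinuousLinearMap
    (mfderiv 𝓘(ℝ, E) 𝓘(ℝ, E) (chartAt E x₀).symm y)

/-- `α` is a smooth form: its coefficients in every chart are smooth. -/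
def Form.IsSmooth (α : Form E X k F) : Prop :=
  ∀ x₀ : X, ContDiffOn ℝ ∞ (α.inChart x₀) (chartAt E x₀).target

/-- The exterior derivative, computed at the point `x` in the preferred chart `φ` at `x`:
`(dα)_x = (φ^* d((φ⁻¹)^* α))_x`. -/
def Form.d (α : Form E X k F) : Form E X (k + 1) F := fun x =>
  (extDeriv (α.inChart x) (chartAt E x x)).compContinuousLinearMap
    (mfderiv 𝓘(ℝ, E) 𝓘(ℝ, E) (chartAt E x) x)

/-- The differential `df` of a real function, as a `1`-form. -/
def dFun (f : X → ℝ) : Form E X 1 ℝ := fun x =>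
  ContinuousAlternatingMap.ofSubsingleton ℝ (TangentSpace 𝓘(ℝ, E) x) ℝ (0 : Fin 1)
    (mvfderiv 𝓘(ℝ, E) f x)

/-- The wedge product `a ∧ b` of two complex-valued real-linear functionals on a real vector space,
`(a ∧ b)(u, v) = a(u) b(v) - a(v) b(u)`. -/
def wedgeLin (a b : E [⋀^Fin 1]→L[ℝ] ℂ) : E [⋀^Fin 2]→L[ℝ] ℂ :=
  ContinuousAlternatingMap.alternatizeUncurryFin
    ((ContinuousLinearMap.lsmul ℝ ℂ).flip b ∘L
      (ContinuousAlternatingMap.ofSubsingletonLIE (𝕜 := ℝ) (E := E) (F := ℂ) (0 : Fin 1)).symm a)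

theorem wedgeLin_apply (a b : E [⋀^Fin 1]→L[ℝ] ℂ) (u v : E) :
    wedgeLin a b ![u, v] = a ![u] * b ![v] - a ![v] * b ![u] := by
  have e : ∀ w : E, (ContinuousAlternatingMap.ofSubsingletonLIE (𝕜 := ℝ) (E := E) (F := ℂ)
      (0 : Fin 1)).symm a w = a ![w] := fun w => by
    refine congrArg a ?_
    ext i; fin_cases i; rfl
  have e1 : Fin.removeNth 0 ![u, v] = ![v] := by ext i; fin_cases i; rfl
  have e2 : Fin.removeNth 1 ![u, v] = ![u] := by ext i; fin_cases i; rfl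
  rw [wedgeLin, ContinuousAlternatingMap.alternatizeUncurryFin_apply, Fin.sum_univ_two, e1, e2]
  have h : ∀ w : E, ((ContinuousLinearMap.lsmul ℝ ℂ).flip b ∘L
      ((ContinuousAlternatingMap.ofSubsingletonLIE (𝕜 := ℝ) (E := E) (F := ℂ)
        (0 : Fin 1)).symm a)) w = a ![w] • b := fun w => by
    rw [ContinuousLinearMap.comp_apply, e]; rfl
  change (-1 : ℤ) ^ ((0 : Fin 2) : ℕ) • (((ContinuousLinearMap.lsmul ℝ ℂ).flip b ∘L
      ((ContinuousAlternatingMap.ofSubsingletonLIE (𝕜 := ℝ) (E := E) (F := ℂ)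
        (0 : Fin 1)).symm a)) u) ![v] + (-1 : ℤ) ^ ((1 : Fin 2) : ℕ) •
        (((ContinuousLinearMap.lsmul ℝ ℂ).flip b ∘L
      ((ContinuousAlternatingMap.ofSubsingletonLIE (𝕜 := ℝ) (E := E) (F := ℂ)
        (0 : Fin 1)).symm a)) v) ![u] = _
  rw [h, h]
  simp [sub_eq_add_neg]

/-- The wedge product of two complex-valued `1`-forms. -/
def Form.wedge (α β : Form E X 1 ℂ) : Form E X 2 ℂ := fun x =>
  wedgeLin (E := E) (α x) (β x)

theorem Form.wedge_apply (α β : Form E X 1 ℂ) (x : X) (u v : TangentSpace 𝓘(ℝ, E) x) :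
    Form.wedge α β x ![u, v] = α x ![u] * β x ![v] - α x ![v] * β x ![u] :=
  wedgeLin_apply (E := E) (α x) (β x) u v

theorem Form.inChart_add (α β : Form E X k F) (x₀ : X) :
    (α + β).inChart x₀ = α.inChart x₀ + β.inChart x₀ := by
  funext y; ext v; rfl

theorem Form.inChart_smul (c : ℝ) (α : Form E X k F) (x₀ : X) :
    (c • α).inChart x₀ = c • α.inChart x₀ := by
  funext y; ext v; rfl

theorem Form.inChart_zero (x₀ : X) : (0 : Form E X k F).inChart x₀ = 0 := by
  funext y; ext v; rfl

theorem Form.IsSmooth.contDiffAt {α : Form E X k F} (h : α.IsSmooth) (x₀ : X) {y : E}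
    (hy : y ∈ (chartAt E x₀).target) : ContDiffAt ℝ ∞ (α.inChart x₀) y :=
  (h x₀).contDiffAt ((chartAt E x₀).open_target.mem_nhds hy)

theorem Form.IsSmooth.differentiableAt {α : Form E X k F} (h : α.IsSmooth) (x₀ : X) {y : E}
    (hy : y ∈ (chartAt E x₀).target) : DifferentiableAt ℝ (α.inChart x₀) y :=
  (h.contDiffAt x₀ hy).differentiableAt (by simp)

theorem Form.IsSmooth.add {α β : Form E X k F} (hα : α.IsSmooth) (hβ : β.IsSmooth) :
    (α + β).IsSmooth := fun x₀ => by
  rw [Form.inChart_add]; exact (hα x₀).add (hβ x₀)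

theorem Form.IsSmooth.smul (c : ℝ) {α : Form E X k F} (hα : α.IsSmooth) :
    (c • α).IsSmooth := fun x₀ => by
  rw [Form.inChart_smul]; exact contDiffOn_const.smul (hα x₀)

theorem Form.isSmooth_zero : (0 : Form E X k F).IsSmooth := fun x₀ => by
  rw [Form.inChart_zero]; exact contDiffOn_const

theorem Form.d_add {α β : Form E X k F} (hα : α.IsSmooth) (hβ : β.IsSmooth) :
    (α + β).d = α.d + β.d := by
  funext x
  have hx : chartAt E x x ∈ (chartAt E x).target := mem_chart_target E x
  simp only [Form.d, Form.inChart_add, Pi.add_apply]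
  rw [extDeriv_add (hα.differentiableAt x hx) (hβ.differentiableAt x hx)]
  rfl

theorem Form.d_smul (c : ℝ) (α : Form E X k F) : (c • α).d = c • α.d := by
  funext x
  simp only [Form.d, Form.inChart_smul, Pi.smul_apply]
  rw [extDeriv_smul]
  rfl

theorem Form.d_zero : (0 : Form E X k F).d = 0 := by
  simpa using Form.d_smul (0 : ℝ) (0 : Form E X k F)

theorem dFun_inChart [IsManifold 𝓘(ℝ, E) ∞ X] {f : X → ℝ} (hf : ContMDiff 𝓘(ℝ, E) 𝓘(ℝ, ℝ) ∞ f)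
    (x₀ : X) {y : E} (hy : y ∈ (chartAt E x₀).target) :
    (dFun f : Form E X 1 ℝ).inChart x₀ y =
      ContinuousAlternatingMap.ofSubsingleton ℝ E ℝ (0 : Fin 1)
        (fderiv ℝ (f ∘ (chartAt E x₀).symm) y) := by
  have hs : MDifferentiableAt 𝓘(ℝ, E) 𝓘(ℝ, E) (chartAt E x₀).symm y :=
    mdifferentiableAt_atlas_symm (chart_mem_atlas E x₀) hy
  have hf' : MDifferentiableAt 𝓘(ℝ, E) 𝓘(ℝ, ℝ) f ((chartAt E x₀).symm y) :=
    hf.mdifferentiable (by simp) _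
  have := mfderiv_comp y hf' hs
  rw [mfderiv_eq_fderiv] at this
  rw [this]
  rfl

theorem contDiffAt_comp_chart [IsManifold 𝓘(ℝ, E) ∞ X] {f : X → ℝ}
    (hf : ContMDiff 𝓘(ℝ, E) 𝓘(ℝ, ℝ) ∞ f) (x₀ : X) {y : E} (hy : y ∈ (chartAt E x₀).target) :
    ContDiffAt ℝ ∞ (f ∘ (chartAt E x₀).symm) y := by
  have h := (hf.contMDiffOn (s := Set.univ)).comp
    (contMDiffOn_chart_symm (I := 𝓘(ℝ, E)) (n := ∞) (x := x₀)) (fun _ _ => Set.mem_univ _)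
  exact h.contDiffOn.contDiffAt ((chartAt E x₀).open_target.mem_nhds hy)

theorem dFun_isSmooth [IsManifold 𝓘(ℝ, E) ∞ X] {f : X → ℝ}
    (hf : ContMDiff 𝓘(ℝ, E) 𝓘(ℝ, ℝ) ∞ f) : (dFun f : Form E X 1 ℝ).IsSmooth := by
  intro x₀
  have : ContDiffOn ℝ ∞ (fun y => ContinuousAlternatingMap.ofSubsingletonLIE (𝕜 := ℝ) (E := E) (F := ℝ) (0 : Fin 1)
      (fderiv ℝ (f ∘ (chartAt E x₀).symm) y)) (chartAt E x₀).target := by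
    intro y hy
    have h := (contDiffAt_comp_chart hf x₀ hy).fderiv_right (m := ∞) (by simp)
    exact ((ContinuousAlternatingMap.ofSubsingletonLIE (𝕜 := ℝ) (E := E) (F := ℝ)
      (0 : Fin 1)).contDiff.contDiffAt.comp y h).contDiffWithinAt
  exact this.congr fun y hy => dFun_inChart hf x₀ hy

theorem dFun_closed [IsManifold 𝓘(ℝ, E) ∞ X] {f : X → ℝ}
    (hf : ContMDiff 𝓘(ℝ, E) 𝓘(ℝ, ℝ) ∞ f) : (dFun f : Form E X 1 ℝ).d = 0 := by
  funext x
  have hx : chartAt E x x ∈ (chartAt E x).target := mem_chart_target E x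
  have hev : (dFun f : Form E X 1 ℝ).inChart x =ᶠ[nhds (chartAt E x x)]
      extDeriv (fun y => ContinuousAlternatingMap.constOfIsEmpty ℝ E (Fin 0)
        ((f ∘ (chartAt E x).symm) y)) := by
    filter_upwards [(chartAt E x).open_target.mem_nhds hx] with y hy
    rw [dFun_inChart hf x hy, extDeriv_constOfIsEmpty]
  have h0 : ContDiffAt ℝ ∞ (fun y => ContinuousAlternatingMap.constOfIsEmpty ℝ E (Fin 0)
        ((f ∘ (chartAt E x).symm) y)) (chartAt E x x) :=
    (ContinuousAlternatingMap.constOfIsEmptyLIE ℝ E ℝ (Fin 0)).contDiff.contDiffAt.comp _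
      (contDiffAt_comp_chart hf x hx)
  simp only [Form.d]
  rw [hev.extDeriv_eq, extDeriv_extDeriv_apply h0 two_le]
  rfl

theorem dFun_add {f g : X → ℝ} (hf : ContMDiff 𝓘(ℝ, E) 𝓘(ℝ, ℝ) ∞ f)
    (hg : ContMDiff 𝓘(ℝ, E) 𝓘(ℝ, ℝ) ∞ g) :
    (dFun (f + g) : Form E X 1 ℝ) = dFun f + dFun g := by
  funext x
  simp only [dFun, Pi.add_apply]
  rw [mvfderiv_add (hf.mdifferentiable (by simp) x) (hg.mdifferentiable (by simp) x)]
  rfl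

theorem dFun_smul (c : ℝ) {f : X → ℝ} (hf : ContMDiff 𝓘(ℝ, E) 𝓘(ℝ, ℝ) ∞ f) :
    (dFun (c • f) : Form E X 1 ℝ) = c • dFun f := by
  funext x
  simp only [dFun, Pi.smul_apply]
  have : mvfderiv 𝓘(ℝ, E) (c • f) x = c • mvfderiv 𝓘(ℝ, E) f x := by
    have := const_smul_mfderiv (hf.mdifferentiable (by simp) x) c
    exact this
  rw [this]
  rfl

theorem dFun_zero : (dFun (0 : X → ℝ) : Form E X 1 ℝ) = 0 := by
  funext x
  have : mvfderiv 𝓘(ℝ, E) (0 : X → ℝ) x = 0 := by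
    exact mfderiv_const
  simp only [dFun, this]
  rfl

variable (E X)

/-- The real vector space of smooth closed real `1`-forms. -/
def closedForms : Submodule ℝ (Form E X 1 ℝ) where
  carrier := {α | α.IsSmooth ∧ α.d = 0}
  zero_mem' := ⟨Form.isSmooth_zero, Form.d_zero⟩
  add_mem' := fun {α β} hα hβ => ⟨hα.1.add hβ.1, by rw [Form.d_add hα.1 hβ.1, hα.2, hβ.2, add_zero]⟩
  smul_mem' := fun c α hα => ⟨hα.1.smul c, by rw [Form.d_smul, hα.2, smul_zero]⟩

/-- The real vector space of exact real `1`-forms `df`, with `f` a smooth real function. -/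
def exactForms : Submodule ℝ (Form E X 1 ℝ) where
  carrier := {α | ∃ f : X → ℝ, ContMDiff 𝓘(ℝ, E) 𝓘(ℝ, ℝ) ∞ f ∧ α = dFun f}
  zero_mem' := ⟨0, contMDiff_const, dFun_zero.symm⟩
  add_mem' := by
    rintro _ _ ⟨f, hf, rfl⟩ ⟨g, hg, rfl⟩
    exact ⟨f + g, hf.add hg, (dFun_add hf hg).symm⟩
  smul_mem' := by
    rintro c _ ⟨f, hf, rfl⟩
    exact ⟨c • f, (contMDiff_const (c := c)).mul hf, (dFun_smul c hf).symm⟩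

theorem exactForms_le_closedForms [IsManifold 𝓘(ℝ, E) ∞ X] : exactForms E X ≤ closedForms E X := by
  rintro _ ⟨f, hf, rfl⟩
  exact ⟨dFun_isSmooth hf, dFun_closed hf⟩

/-- The first de Rham cohomology `H¹_dR(X, ℝ)`: closed `1`-forms modulo exact `1`-forms. -/
abbrev DeRhamH1 : Type _ := closedForms E X ⧸ (exactForms E X).submoduleOf (closedForms E X)

variable {E X}

/-- The de Rham class `[α]` of a closed `1`-form. -/
abbrev deRhamClass (α : closedForms E X) : DeRhamH1 E X :=
  ((exactForms E X).submoduleOf (closedForms E X)).mkQ α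

theorem deRhamClass_eq_iff (α β : closedForms E X) : deRhamClass α = deRhamClass β ↔
    ∃ f : X → ℝ, ContMDiff 𝓘(ℝ, E) 𝓘(ℝ, ℝ) ∞ f ∧ α.1 = β.1 + dFun f := by
  refine (Submodule.Quotient.eq _).trans ⟨?_, ?_⟩
  · rintro ⟨f, hf, h⟩
    have h' : α.1 - β.1 = dFun f := h
    exact ⟨f, hf, sub_eq_iff_eq_add'.1 h'⟩
  · rintro ⟨f, hf, h⟩
    exact ⟨f, hf, sub_eq_iff_eq_add'.2 h⟩

end Forms

section Pullback

variable {E : Type*} [NormedAddCommGroup E] [NormedSpace ℝ E]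
  {X : Type*} [TopologicalSpace X] [ChartedSpace E X]
  {E' : Type*} [NormedAddCommGroup E'] [NormedSpace ℝ E']
  {Y : Type*} [TopologicalSpace Y] [ChartedSpace E' Y]
  {F : Type*} [NormedAddCommGroup F] [NormedSpace ℝ F] {k : ℕ}

/-- The pullback `Φ^* α` of a form along a map `Φ : Y → X`. -/
def Form.pullback (Φ : Y → X) (α : Form E X k F) : Form E' Y k F := fun y =>
  (α (Φ y)).compContinuousLinearMap (mfderiv 𝓘(ℝ, E') 𝓘(ℝ, E) Φ y)

theorem Form.inChart_apply (α : Form E X k F) (x₀ : X) {z : X}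
    (hz : z ∈ (chartAt E x₀).source) :
    α.inChart x₀ (chartAt E x₀ z) =
      (show E [⋀^Fin k]→L[ℝ] F from α z).compContinuousLinearMap
        (show E →L[ℝ] E from
          mfderiv 𝓘(ℝ, E) 𝓘(ℝ, E) (chartAt E x₀).symm (chartAt E x₀ z)) := by
  have h : (chartAt E x₀).symm (chartAt E x₀ z) = z := (chartAt E x₀).left_inv hz
  let α' : X → E [⋀^Fin k]→L[ℝ] F := α
  have h' : α' ((chartAt E x₀).symm (chartAt E x₀ z)) = α' z := by rw [h]
  exact congrArg (fun a : E [⋀^Fin k]→L[ℝ] F => a.compContinuousLinearMap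
    (show E →L[ℝ] E from mfderiv 𝓘(ℝ, E) 𝓘(ℝ, E) (chartAt E x₀).symm (chartAt E x₀ z))) h'

/-- The coordinate expression of a map between manifolds. -/
def coordMap (Φ : Y → X) (y₀ : Y) (x₀ : X) : E' → E :=
  chartAt E x₀ ∘ Φ ∘ (chartAt E' y₀).symm

theorem coordMap_contDiffAt [IsManifold 𝓘(ℝ, E) ∞ X] [IsManifold 𝓘(ℝ, E') ∞ Y] {Φ : Y → X}
    (hΦ : ContMDiff 𝓘(ℝ, E') 𝓘(ℝ, E) ∞ Φ) (y₀ : Y) (x₀ : X) {w : E'}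
    (hw : w ∈ (chartAt E' y₀).target)
    (hx : Φ ((chartAt E' y₀).symm w) ∈ (chartAt E x₀).source) :
    ContDiffAt ℝ ∞ (coordMap (E := E) (E' := E') Φ y₀ x₀) w := by
  have h1 : ContMDiffAt 𝓘(ℝ, E') 𝓘(ℝ, E') ∞ (chartAt E' y₀).symm w :=
    (contMDiffOn_chart_symm (I := 𝓘(ℝ, E')) (n := ∞) (x := y₀)).contMDiffAt
      ((chartAt E' y₀).open_target.mem_nhds hw)
  have h3 : ContMDiffAt 𝓘(ℝ, E) 𝓘(ℝ, E) ∞ (chartAt E x₀) (Φ ((chartAt E' y₀).symm w)) :=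
    (contMDiffOn_chart (I := 𝓘(ℝ, E)) (n := ∞) (x := x₀)).contMDiffAt
      ((chartAt E x₀).open_source.mem_nhds hx)
  exact (h3.comp w ((hΦ _).comp w h1)).contDiffAt

theorem Form.inChart_pullback [IsManifold 𝓘(ℝ, E) ∞ X] [IsManifold 𝓘(ℝ, E') ∞ Y] {Φ : Y → X}
    (hΦ : ContMDiff 𝓘(ℝ, E') 𝓘(ℝ, E) ∞ Φ) (α : Form E X k F) (y₀ : Y) (x₀ : X) {w : E'}
    (hw : w ∈ (chartAt E' y₀).target)
    (hx : Φ ((chartAt E' y₀).symm w) ∈ (chartAt E x₀).source) :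
    (Form.pullback Φ α : Form E' Y k F).inChart y₀ w =
      (α.inChart x₀ (coordMap (E := E) (E' := E') Φ y₀ x₀ w)).compContinuousLinearMap
        (fderiv ℝ (coordMap (E := E) (E' := E') Φ y₀ x₀) w) := by
  have h1 : MDifferentiableAt 𝓘(ℝ, E') 𝓘(ℝ, E') (chartAt E' y₀).symm w :=
    mdifferentiableAt_atlas_symm (chart_mem_atlas E' y₀) hw
  have h2 : MDifferentiableAt 𝓘(ℝ, E') 𝓘(ℝ, E) Φ ((chartAt E' y₀).symm w) :=
    hΦ.mdifferentiable (by simp) _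
  have h21 : MDifferentiableAt 𝓘(ℝ, E') 𝓘(ℝ, E) (Φ ∘ (chartAt E' y₀).symm) w := h2.comp w h1
  have h3 : MDifferentiableAt 𝓘(ℝ, E) 𝓘(ℝ, E) (chartAt E x₀) ((Φ ∘ (chartAt E' y₀).symm) w) :=
    mdifferentiableAt_atlas (chart_mem_atlas E x₀) hx
  have h4 : MDifferentiableAt 𝓘(ℝ, E) 𝓘(ℝ, E) (chartAt E x₀).symm
      (chartAt E x₀ ((Φ ∘ (chartAt E' y₀).symm) w)) :=
    mdifferentiableAt_atlas_symm (chart_mem_atlas E x₀) ((chartAt E x₀).map_source hx)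
  have e1 := mfderiv_comp w h2 h1
  have e2 := mfderiv_comp w h3 h21
  have hg : MDifferentiableAt 𝓘(ℝ, E') 𝓘(ℝ, E) (coordMap (E := E) (E' := E') Φ y₀ x₀) w :=
    h3.comp w h21
  have e3 := mfderiv_comp w (g := (chartAt E x₀).symm) h4 hg
  have hev : ((chartAt E x₀).symm ∘ coordMap (E := E) (E' := E') Φ y₀ x₀)
      =ᶠ[nhds w] Φ ∘ (chartAt E' y₀).symm := by
    have hc : ContinuousAt (Φ ∘ (chartAt E' y₀).symm) w := h21.continuousAt
    filter_upwards [hc ((chartAt E x₀).open_source.mem_nhds hx)] with v hv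
    exact (chartAt E x₀).left_inv hv
  rw [hev.mfderiv_eq, e1] at e3
  rw [mfderiv_eq_fderiv] at e3
  change _ = (α.inChart x₀ (chartAt E x₀ (Φ ((chartAt E' y₀).symm w)))).compContinuousLinearMap _
  rw [Form.inChart_apply α x₀ hx]
  ext v
  have e4 : ∀ u : E', (mfderiv 𝓘(ℝ, E') 𝓘(ℝ, E) Φ ((chartAt E' y₀).symm w))
      ((mfderiv 𝓘(ℝ, E') 𝓘(ℝ, E') (chartAt E' y₀).symm w) u) =
      (mfderiv 𝓘(ℝ, E) 𝓘(ℝ, E) (chartAt E x₀).symm (coordMap (E := E) (E' := E') Φ y₀ x₀ w))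
        (fderiv ℝ (coordMap (E := E) (E' := E') Φ y₀ x₀) w u) := fun u =>
    congrArg (fun (T : E' →L[ℝ] E) => T u) e3
  exact congrArg (show E [⋀^Fin k]→L[ℝ] F from α (Φ ((chartAt E' y₀).symm w)))
    (funext fun i => e4 (v i))

theorem Form.IsSmooth.pullback [IsManifold 𝓘(ℝ, E) ∞ X] [IsManifold 𝓘(ℝ, E') ∞ Y] {Φ : Y → X}
    (hΦ : ContMDiff 𝓘(ℝ, E') 𝓘(ℝ, E) ∞ Φ) {α : Form E X 1 F} (hα : α.IsSmooth) :
    (Form.pullback Φ α : Form E' Y 1 F).IsSmooth := by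
  intro y₀ w hw
  refine ContDiffAt.contDiffWithinAt ?_
  set x₀ : X := Φ ((chartAt E' y₀).symm w) with hx₀
  have hx : Φ ((chartAt E' y₀).symm w) ∈ (chartAt E x₀).source := mem_chart_source E _
  set g := coordMap (E := E) (E' := E') Φ y₀ x₀ with hgdef
  have hg : ContDiffAt ℝ ∞ g w := coordMap_contDiffAt hΦ y₀ x₀ hw hx
  have hαw : ContDiffAt ℝ ∞ (α.inChart x₀) (g w) :=
    hα.contDiffAt x₀ ((chartAt E x₀).map_source hx)
  let L := ContinuousAlternatingMap.ofSubsingletonLIE (𝕜 := ℝ) (E := E) (F := F) (0 : Fin 1)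
  let L' := ContinuousAlternatingMap.ofSubsingletonLIE (𝕜 := ℝ) (E := E') (F := F) (0 : Fin 1)
  have key : ContDiffAt ℝ ∞ (fun v => L' ((L.symm (α.inChart x₀ (g v))).comp (fderiv ℝ g v))) w := by
    refine L'.contDiff.contDiffAt.comp w ?_
    exact (L.symm.contDiff.contDiffAt.comp w (hαw.comp w hg)).clm_comp
      (hg.fderiv_right (m := ∞) (by simp))
  refine key.congr_of_eventuallyEq ?_
  have hc : ContinuousAt (Φ ∘ (chartAt E' y₀).symm) w :=
    hΦ.continuous.continuousAt.comp ((chartAt E' y₀).continuousAt_symm hw)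
  filter_upwards [hc ((chartAt E x₀).open_source.mem_nhds hx),
    (chartAt E' y₀).open_target.mem_nhds hw] with v hv hv'
  rw [Form.inChart_pullback hΦ α y₀ x₀ hv' hv]
  ext u
  change (α.inChart x₀ (g v)) _ = (α.inChart x₀ (g v)) _
  congr 1
  funext i
  fin_cases i
  rfl

theorem Form.d_pullback [IsManifold 𝓘(ℝ, E) ∞ X] [IsManifold 𝓘(ℝ, E') ∞ Y] {Φ : Y → X}
    (hΦ : ContMDiff 𝓘(ℝ, E') 𝓘(ℝ, E) ∞ Φ) {α : Form E X k F} (hα : α.IsSmooth) :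
    (Form.pullback Φ α : Form E' Y k F).d = Form.pullback Φ α.d := by
  funext y
  have hw : chartAt E' y y ∈ (chartAt E' y).target := mem_chart_target E' y
  have hy : (chartAt E' y).symm (chartAt E' y y) = y :=
    (chartAt E' y).left_inv (mem_chart_source E' y)
  have hx : Φ ((chartAt E' y).symm (chartAt E' y y)) ∈ (chartAt E (Φ y)).source := by
    rw [hy]; exact mem_chart_source E _
  set g := coordMap (E := E) (E' := E') Φ y (Φ y) with hgdef
  have hgw : g (chartAt E' y y) = chartAt E (Φ y) (Φ y) := by
    simp only [hgdef, coordMap, Function.comp_apply, hy]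
  have hg : ContDiffAt ℝ ∞ g (chartAt E' y y) := coordMap_contDiffAt hΦ y (Φ y) hw hx
  have hc : ContinuousAt (Φ ∘ (chartAt E' y).symm) (chartAt E' y y) :=
    hΦ.continuous.continuousAt.comp ((chartAt E' y).continuousAt_symm hw)
  have hev : (Form.pullback Φ α : Form E' Y k F).inChart y =ᶠ[nhds (chartAt E' y y)]
      fun v => (α.inChart (Φ y) (g v)).compContinuousLinearMap (fderiv ℝ g v) := by
    filter_upwards [hc ((chartAt E (Φ y)).open_source.mem_nhds hx),
      (chartAt E' y).open_target.mem_nhds hw] with v hv hv'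
    exact Form.inChart_pullback hΦ α y (Φ y) hv' hv
  have hd : DifferentiableAt ℝ (α.inChart (Φ y)) (g (chartAt E' y y)) := by
    rw [hgw]; exact hα.differentiableAt _ (mem_chart_target E _)
  have hφ : MDifferentiableAt 𝓘(ℝ, E') 𝓘(ℝ, E') (chartAt E' y) y :=
    mdifferentiableAt_atlas (chart_mem_atlas E' y) (mem_chart_source E' y)
  have hψ : MDifferentiableAt 𝓘(ℝ, E) 𝓘(ℝ, E) (chartAt E (Φ y)) (Φ y) :=
    mdifferentiableAt_atlas (chart_mem_atlas E _) (mem_chart_source E _)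
  have hΦy : MDifferentiableAt 𝓘(ℝ, E') 𝓘(ℝ, E) Φ y := hΦ.mdifferentiable (by simp) _
  have hgm : MDifferentiableAt 𝓘(ℝ, E') 𝓘(ℝ, E) g (chartAt E' y y) :=
    (hg.differentiableAt (by simp)).mdifferentiableAt
  have hcomp : g ∘ chartAt E' y =ᶠ[nhds y] chartAt E (Φ y) ∘ Φ := by
    filter_upwards [(chartAt E' y).open_source.mem_nhds (mem_chart_source E' y)] with z hz
    simp only [hgdef, coordMap, Function.comp_apply, (chartAt E' y).left_inv hz]
  have e1 := mfderiv_comp y hgm hφ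
  rw [hcomp.mfderiv_eq, mfderiv_comp y hψ hΦy, mfderiv_eq_fderiv] at e1
  simp only [Form.d, Form.pullback]
  change (extDeriv ((Form.pullback Φ α : Form E' Y k F).inChart y) _).compContinuousLinearMap _ = _
  rw [hev.extDeriv_eq, extDeriv_pullback hd hg two_le, hgw]
  ext v
  exact congrArg (extDeriv (α.inChart (Φ y)) (chartAt E (Φ y) (Φ y)))
    (funext fun i => (congrArg (fun (T : E' →L[ℝ] E) => T (v i)) e1).symm)

theorem pullback_dFun {Φ : Y → X} (hΦ : ContMDiff 𝓘(ℝ, E') 𝓘(ℝ, E) ∞ Φ) {f : X → ℝ}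
    (hf : ContMDiff 𝓘(ℝ, E) 𝓘(ℝ, ℝ) ∞ f) :
    (Form.pullback Φ (dFun f : Form E X 1 ℝ) : Form E' Y 1 ℝ) = dFun (f ∘ Φ) := by
  funext y
  have e := mfderiv_comp y (hf.mdifferentiable (by simp) (Φ y)) (hΦ.mdifferentiable (by simp) y)
  ext v
  exact (congrArg (fun (T : E' →L[ℝ] ℝ) => T (v 0)) e).symm

/-- Pullback of closed `1`-forms along a smooth map. -/
def pullbackClosed [IsManifold 𝓘(ℝ, E) ∞ X] [IsManifold 𝓘(ℝ, E') ∞ Y] (Φ : Y → X)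
    (hΦ : ContMDiff 𝓘(ℝ, E') 𝓘(ℝ, E) ∞ Φ) : closedForms E X →ₗ[ℝ] closedForms E' Y where
  toFun α := ⟨Form.pullback Φ α.1, α.2.1.pullback hΦ, by
    rw [Form.d_pullback hΦ α.2.1, α.2.2]; rfl⟩
  map_add' _ _ := rfl
  map_smul' _ _ := rfl

/-- The map `Φ^* : H¹_dR(X, ℝ) → H¹_dR(Y, ℝ)`, `[α] ↦ [Φ^* α]`, induced by a smooth map. -/
def pullbackH1 [IsManifold 𝓘(ℝ, E) ∞ X] [IsManifold 𝓘(ℝ, E') ∞ Y] (Φ : Y → X)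
    (hΦ : ContMDiff 𝓘(ℝ, E') 𝓘(ℝ, E) ∞ Φ) : DeRhamH1 E X →ₗ[ℝ] DeRhamH1 E' Y :=
  Submodule.mapQ _ _ (pullbackClosed Φ hΦ) (by
    rintro ⟨_, hα⟩ ⟨f, hf, rfl⟩
    exact ⟨f ∘ Φ, hf.comp hΦ, pullback_dFun hΦ hf⟩)

end Pullback

section Complex

variable {E : Type*} [NormedAddCommGroup E] [NormedSpace ℂ E]
  {X : Type*} [TopologicalSpace X] [ChartedSpace E X]

/-- The complex structure `J` of the real tangent space `T_x X` of a complex manifold: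
multiplication by `i` in the preferred chart at `x`. -/
def J (x : X) : TangentSpace 𝓘(ℝ, E) x →L[ℝ] TangentSpace 𝓘(ℝ, E) x :=
  show E →L[ℝ] E from (Complex.I • ContinuousLinearMap.id ℂ E).restrictScalars ℝ

/-- A real form seen as a complex-valued form. -/
def Form.toComplex {k : ℕ} (α : Form E X k ℝ) : Form E X k ℂ := fun x =>
  Complex.ofRealCLM.compContinuousAlternatingMap (α x)

/-- The `(1,0)`-part `ω_{1,0} = (ω - i ω ∘ J) / 2` of a complex-valued `1`-form. -/
def Form.part10 (α : Form E X 1 ℂ) : Form E X 1 ℂ := fun x =>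
  (1 / 2 : ℂ) • (α x - Complex.I • (α x).compContinuousLinearMap (J x))

/-- The `(0,1)`-part `ω_{0,1} = (ω + i ω ∘ J) / 2` of a complex-valued `1`-form. -/
def Form.part01 (α : Form E X 1 ℂ) : Form E X 1 ℂ := fun x =>
  (1 / 2 : ℂ) • (α x + Complex.I • (α x).compContinuousLinearMap (J x))

/-- The `(1,1)`-part `(ω + ω(J·, J·)) / 2` of a complex-valued `2`-form. -/
def Form.part11 (α : Form E X 2 ℂ) : Form E X 2 ℂ := fun x =>
  (1 / 2 : ℂ) • (α x + (α x).compContinuousLinearMap (J x))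

/-- The operator `∂̄` on forms of type `(1,0)`: the `(1,1)`-part of the exterior derivative. -/
def Form.dbar (α : Form E X 1 ℂ) : Form E X 2 ℂ := α.d.part11

variable (E) in
/-- The complexified tangent space `ℂ ⊗ T_x X`; the pair `(u, v)` stands for `u + i v`. -/
abbrev CTangent (x : X) := TangentSpace 𝓘(ℝ, E) x × TangentSpace 𝓘(ℝ, E) x

/-- Complex conjugation on `ℂ ⊗ T_x X`. -/
def CTangent.conj {x : X} (L : CTangent E x) : CTangent E x := (L.1, -L.2)

variable (E) in
/-- The holomorphic tangent space `T^{1,0}_x X`, the `i`-eigenspace of `J` in `ℂ ⊗ T_x X`: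
`J (u + i v) = i (u + i v)`, i.e. `J u = -v` and `J v = u`. -/
def T10 (x : X) : Set (CTangent E x) := {L | J x L.1 = -L.2 ∧ J x L.2 = L.1}

/-- The value `ω(L, M)` of the `ℂ`-bilinear extension of a complex-valued `2`-form to
`ℂ ⊗ T_x X`. -/
def Form.ceval (α : Form E X 2 ℂ) {x : X} (L M : CTangent E x) : ℂ :=
  α x ![L.1, M.1] + Complex.I * α x ![L.1, M.2] + Complex.I * α x ![L.2, M.1] - α x ![L.2, M.2]

/-- The inequality `α ≤ β` in the sense of Hermitian forms on `T^{1,0} X`, where `α` and `β` induce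
Hermitian forms `(L, M) ↦ α(L, M̄)`, whose diagonal values are real. -/
def HermitianLE (α β : Form E X 2 ℂ) : Prop :=
  ∀ (x : X), ∀ L ∈ T10 E x, (α.ceval L L.conj).re ≤ (β.ceval L L.conj).re

/-- `𝔫_{X,0}(α) = inf {t > 0 : α_{1,0} ∧ α_{0,1} ≤ t ∂̄ α_{1,0}}`, with `inf ∅ = +∞`. -/
def normForm (α : Form E X 1 ℝ) : ENNReal :=
  ⨅ (t : ℝ) (_ : 0 < t ∧
    HermitianLE (Form.wedge α.toComplex.part10 α.toComplex.part01)
      (t • α.toComplex.part10.dbar)), ENNReal.ofReal t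

/-- `𝔫_X(c) = inf {𝔫_{X,0}(β) : β closed, [β] = c}` for a class `c` in `H¹_dR(X, ℝ)`. -/
def normClass (c : DeRhamH1 E X) : ENNReal :=
  ⨅ (β : closedForms E X) (_ : deRhamClass β = c), normForm β.1

theorem isManifold_real [IsManifold 𝓘(ℂ, E) ω X] : IsManifold 𝓘(ℝ, E) ∞ X := by
  refine isManifold_of_contDiffOn 𝓘(ℝ, E) ∞ X fun e e' he he' => ?_
  have h := StructureGroupoid.compatible (contDiffGroupoid ω 𝓘(ℂ, E)) he he'
  rw [contDiffGroupoid, mem_groupoid_of_pregroupoid] at h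
  have h1 : ContDiffOn ℂ ω (𝓘(ℂ, E) ∘ (e.symm ≫ₕ e') ∘ 𝓘(ℂ, E).symm)
      (𝓘(ℂ, E).symm ⁻¹' (e.symm ≫ₕ e').source ∩ Set.range 𝓘(ℂ, E)) := h.1
  exact (h1.restrict_scalars ℝ).of_le le_top

variable {E' : Type*} [NormedAddCommGroup E'] [NormedSpace ℂ E']
  {Y : Type*} [TopologicalSpace Y] [ChartedSpace E' Y]

theorem contMDiff_real [IsManifold 𝓘(ℂ, E) ω X] [IsManifold 𝓘(ℂ, E') ω Y] {Φ : Y → X}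
    (hΦ : ContMDiff 𝓘(ℂ, E') 𝓘(ℂ, E) ω Φ) : ContMDiff 𝓘(ℝ, E') 𝓘(ℝ, E) ∞ Φ := by
  have : IsManifold 𝓘(ℝ, E) ∞ X := isManifold_real
  have : IsManifold 𝓘(ℝ, E') ∞ Y := isManifold_real
  rw [contMDiff_iff] at hΦ ⊢
  exact ⟨hΦ.1, fun y x => ((hΦ.2 y x).restrict_scalars ℝ).of_le le_top⟩

/-- The map `Φ^* : H¹_dR(X, ℝ) → H¹_dR(Y, ℝ)`, `[α] ↦ [Φ^* α]`, induced by a holomorphic map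
between complex manifolds. -/
def holPullback [IsManifold 𝓘(ℂ, E) ω X] [IsManifold 𝓘(ℂ, E') ω Y] (Φ : Y → X)
    (hΦ : ContMDiff 𝓘(ℂ, E') 𝓘(ℂ, E) ω Φ) : DeRhamH1 E X →ₗ[ℝ] DeRhamH1 E' Y :=
  haveI : IsManifold 𝓘(ℝ, E) ∞ X := isManifold_real
  haveI : IsManifold 𝓘(ℝ, E') ∞ Y := isManifold_real
  pullbackH1 Φ (contMDiff_real hΦ)

/-- The second description of `𝔫_X([α])`, as `inf {𝔫_{X,0}(α + df) : f ∈ C^∞(X, ℝ)}`. -/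
theorem normClass_mk [IsManifold 𝓘(ℂ, E) ω X] (α : closedForms E X) :
    normClass (deRhamClass α) =
      ⨅ (f : X → ℝ) (_ : ContMDiff 𝓘(ℝ, E) 𝓘(ℝ, ℝ) ∞ f), normForm (α.1 + dFun f) := by
  have : IsManifold 𝓘(ℝ, E) ∞ X := isManifold_real
  apply le_antisymm
  · refine le_iInf₂ fun f hf => ?_
    have hmem : α.1 + dFun f ∈ closedForms E X :=
      (closedForms E X).add_mem α.2 ⟨dFun_isSmooth hf, dFun_closed hf⟩
    exact iInf₂_le (f := fun (β : closedForms E X) (_ : deRhamClass β = deRhamClass α) =>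
      normForm β.1) ⟨α.1 + dFun f, hmem⟩ ((deRhamClass_eq_iff _ _).2 ⟨f, hf, rfl⟩)
  · refine le_iInf₂ fun β hβ => ?_
    obtain ⟨f, hf, h⟩ := (deRhamClass_eq_iff _ _).1 hβ
    rw [h]
    exact iInf₂_le (f := fun (f : X → ℝ) (_ : ContMDiff 𝓘(ℝ, E) 𝓘(ℝ, ℝ) ∞ f) =>
      normForm (α.1 + dFun f)) f hf

end Complex

end HolNorm

end

/-!
Write a real closed form locally as `α = du`. At the vector `e - i J e` of `T^{1,0}` the Hermitian
form of `α_{1,0} ∧ α_{0,1}` takes the value `du(e)² + du(Je)²`, and that of `∂̄ α_{1,0}`, called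
`levi` below, takes the value `-(D²u(e, e) + D²u(Je, Je))`. So a constant `t` is admissible for
`𝔫_{X,0}(α)` exactly if `u` satisfies the differential inequalities `|∇u|² ≤ -t Δu` on all complex
lines (`hermitianLE_iff`, `levi_inChart`).

Homogeneity is the linearity of `levi`. The quasi-triangle inequality is
`(a + b)² ≤ 2 a² + 2 b²` together with the nonnegativity of `levi` on admissible forms.
Functoriality holds because a holomorphic map has a differential commuting with `J`
(`mfderiv_J`), so that both Hermitian forms pull back (`levi_pullback`).

The substance is non-degeneracy. Suppose `𝔫_X([α]) = 0` and choose functions `f k` such that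
`β k = α + d(f k)` satisfies the inequality with a constant `t k ≤ 2⁻ᵏ`. Multiplying it by the square
of a cutoff function and integrating by parts bounds the local `L²` norm of `β k` in each direction
by a constant times `t k` (`energy_estimate`). The local `L¹` norms are therefore summable in `k`. If
`u` is a primitive of `α` on a ball, the functions `f k + u` have differential `β k`; by Fubini their
increments along almost every segment tend to zero, whence, up to constants `c k`, the `f k`
converge almost everywhere to `-u` on a smaller ball (`exists_ae_tendsto_sub`).

Coordinate changes preserve null sets, so on an overlap of two such balls the differences of the
constants converge, and their limit is the difference of the two primitives. This makes the local
primitives agree after subtracting the limits of the constants relative to a representative of each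
class of mutually comparable balls, and yields a global primitive of `α`
(`mem_exactForms_of_local_ae_tendsto`).
-/

noncomputable section

namespace HolNorm

/-! ### Forms read in a chart -/

section ChartFormulas

variable {E : Type*} [NormedAddCommGroup E] [NormedSpace ℝ E]
  {X : Type*} [TopologicalSpace X] [ChartedSpace E X]
  {F : Type*} [NormedAddCommGroup F] [NormedSpace ℝ F] {k : ℕ}

theorem Form.pullback_id (α : Form E X k F) : (Form.pullback id α : Form E X k F) = α := by
  funext x
  simp only [Form.pullback, mfderiv_id]
  rfl

theorem Form.inChart_eq_inChart_coordMap [IsManifold 𝓘(ℝ, E) ∞ X] (α : Form E X k F) (x₀ x₁ : X)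
    {w : E} (hw : w ∈ (chartAt E x₀).target) (hx : (chartAt E x₀).symm w ∈ (chartAt E x₁).source) :
    α.inChart x₀ w =
      (α.inChart x₁ (coordMap (E := E) (E' := E) (id : X → X) x₀ x₁ w)).compContinuousLinearMap
        (fderiv ℝ (coordMap (E := E) (E' := E) (id : X → X) x₀ x₁) w) := by
  have := Form.inChart_pullback (E := E) (E' := E) (Φ := (id : X → X)) contMDiff_id α x₀ x₁ hw hx
  rwa [Form.pullback_id] at this

/-- The exterior derivative, defined at each point in the preferred chart, is computed by the
Euclidean exterior derivative in any chart of the family. -/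
theorem Form.inChart_d [IsManifold 𝓘(ℝ, E) ∞ X] {α : Form E X k F} (hα : α.IsSmooth) (x₀ : X)
    {w : E} (hw : w ∈ (chartAt E x₀).target) :
    α.d.inChart x₀ w = extDeriv (α.inChart x₀) w := by
  set z : X := (chartAt E x₀).symm w with hz
  have hx : z ∈ (chartAt E z).source := mem_chart_source E z
  set g := coordMap (E := E) (E' := E) (id : X → X) x₀ z with hgdef
  have hgw : g w = chartAt E z z := rfl
  have hg : ContDiffAt ℝ ∞ g w := coordMap_contDiffAt contMDiff_id x₀ z hw hx
  have hc : ContinuousAt (chartAt E x₀).symm w := (chartAt E x₀).continuousAt_symm hw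
  have hev : α.inChart x₀ =ᶠ[nhds w]
      fun v => (α.inChart z (g v)).compContinuousLinearMap (fderiv ℝ g v) := by
    filter_upwards [hc ((chartAt E z).open_source.mem_nhds hx),
      (chartAt E x₀).open_target.mem_nhds hw] with v hv hv'
    exact Form.inChart_eq_inChart_coordMap α x₀ z hv' hv
  have hd : DifferentiableAt ℝ (α.inChart z) (g w) := by
    rw [hgw]; exact hα.differentiableAt _ (mem_chart_target E _)
  have hs : MDifferentiableAt 𝓘(ℝ, E) 𝓘(ℝ, E) (chartAt E x₀).symm w :=
    mdifferentiableAt_atlas_symm (chart_mem_atlas E x₀) hw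
  have hφ : MDifferentiableAt 𝓘(ℝ, E) 𝓘(ℝ, E) (chartAt E z) z :=
    mdifferentiableAt_atlas (chart_mem_atlas E z) (mem_chart_source E z)
  have e := mfderiv_comp w hφ hs
  have e1 : fderiv ℝ g w = _ := (mfderiv_eq_fderiv (f := g) (x := w)).symm.trans e
  rw [hev.extDeriv_eq, extDeriv_pullback hd hg two_le, e1, hgw]
  rfl

/-- A form is determined at a point by its expression in the preferred chart at that point, the
differential of the chart being invertible. -/
theorem Form.ext_inChart [IsManifold 𝓘(ℝ, E) ∞ X] {α β : Form E X k F} (x : X)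
    (h : α.inChart x (chartAt E x x) = β.inChart x (chartAt E x x)) : α x = β x := by
  have hx : x ∈ (chartAt E x).source := mem_chart_source E x
  rw [Form.inChart_apply α x hx, Form.inChart_apply β x hx] at h
  have hmd := mdifferentiable_chart (I := 𝓘(ℝ, E)) x
  have hid := hmd.symm_comp_deriv hx
  ext v
  have e : ∀ u : E, (show E →L[ℝ] E from
      mfderiv 𝓘(ℝ, E) 𝓘(ℝ, E) (chartAt E x).symm (chartAt E x x))
      ((show E →L[ℝ] E from mfderiv 𝓘(ℝ, E) 𝓘(ℝ, E) (chartAt E x) x) u) = u := fun u =>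
    congrArg (fun T : E →L[ℝ] E => T u) hid
  have h2 := congrArg (fun T : E [⋀^Fin k]→L[ℝ] F => T fun i =>
    (show E →L[ℝ] E from mfderiv 𝓘(ℝ, E) 𝓘(ℝ, E) (chartAt E x) x) (v i)) h
  have e2 : (fun i => (show E →L[ℝ] E from
      mfderiv 𝓘(ℝ, E) 𝓘(ℝ, E) (chartAt E x).symm (chartAt E x x))
      ((show E →L[ℝ] E from mfderiv 𝓘(ℝ, E) 𝓘(ℝ, E) (chartAt E x) x) (v i))) = v :=
    funext fun i => e (v i)
  have h3 : ∀ γ : E [⋀^Fin k]→L[ℝ] F, γ (fun i => (show E →L[ℝ] E from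
      mfderiv 𝓘(ℝ, E) 𝓘(ℝ, E) (chartAt E x).symm (chartAt E x x))
      ((show E →L[ℝ] E from mfderiv 𝓘(ℝ, E) 𝓘(ℝ, E) (chartAt E x) x) (v i))) = γ v :=
    fun γ => congrArg γ e2
  exact (h3 (α x)).symm.trans (h2.trans (h3 (β x)))

end ChartFormulas

/-! ### Types and holomorphic maps -/

section ComplexStructure

variable {E : Type*} [NormedAddCommGroup E] [NormedSpace ℂ E]
  {X : Type*} [TopologicalSpace X] [ChartedSpace E X]
  {E' : Type*} [NormedAddCommGroup E'] [NormedSpace ℂ E']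
  {Y : Type*} [TopologicalSpace Y] [ChartedSpace E' Y]

variable (E) in
/-- Multiplication by `i` on a complex normed space, as a real-linear map. -/
def mulI : E →L[ℝ] E := (Complex.I • ContinuousLinearMap.id ℂ E).restrictScalars ℝ

theorem J_J (x : X) (v : TangentSpace 𝓘(ℝ, E) x) : J x (J x v) = -v := by
  change (Complex.I • Complex.I • (show E from v)) = -(show E from v)
  rw [smul_smul, Complex.I_mul_I, neg_one_smul]

/-- A holomorphic map has complex-linear differential. -/
theorem mfderiv_J {Φ : Y → X} {y : Y} (hΦ : MDifferentiableAt 𝓘(ℂ, E') 𝓘(ℂ, E) Φ y)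
    (v : TangentSpace 𝓘(ℝ, E') y) :
    mfderiv 𝓘(ℝ, E') 𝓘(ℝ, E) Φ y (J y v) = J (Φ y) (mfderiv 𝓘(ℝ, E') 𝓘(ℝ, E) Φ y v) := by
  have h : HasMFDerivAt 𝓘(ℝ, E') 𝓘(ℝ, E) Φ y
      ((show E' →L[ℂ] E from mfderiv 𝓘(ℂ, E') 𝓘(ℂ, E) Φ y).restrictScalars ℝ) :=
    ⟨hΦ.continuousAt, hΦ.hasMFDerivAt.2.restrictScalars ℝ⟩
  rw [h.mfderiv]
  exact (show E' →L[ℂ] E from mfderiv 𝓘(ℂ, E') 𝓘(ℂ, E) Φ y).map_smul Complex.I (show E' from v)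

theorem Form.part10_pullback {Φ : Y → X} (hΦ : MDifferentiable 𝓘(ℂ, E') 𝓘(ℂ, E) Φ)
    (α : Form E X 1 ℂ) :
    (Form.pullback Φ α : Form E' Y 1 ℂ).part10 = Form.pullback Φ α.part10 := by
  funext y
  ext v
  have e : (fun i => mfderiv 𝓘(ℝ, E') 𝓘(ℝ, E) Φ y (J y (v i))) =
      fun i => J (Φ y) (mfderiv 𝓘(ℝ, E') 𝓘(ℝ, E) Φ y (v i)) :=
    funext fun i => mfderiv_J (hΦ y) (v i)
  have := congrArg (fun w => (1 / 2 : ℂ) •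
    (α (Φ y) (fun i => mfderiv 𝓘(ℝ, E') 𝓘(ℝ, E) Φ y (v i)) - Complex.I • α (Φ y) w)) e
  exact this

/-- The chart expression of the `(1,0)`-part, the charts being holomorphic. -/
theorem Form.inChart_part10 [IsManifold 𝓘(ℂ, E) ω X] (α : Form E X 1 ℂ) (x₀ : X) {w : E}
    (hw : w ∈ (chartAt E x₀).target) :
    α.part10.inChart x₀ w = (1 / 2 : ℂ) • (α.inChart x₀ w -
      Complex.I • (α.inChart x₀ w).compContinuousLinearMap (mulI E)) := by
  have hs : MDifferentiableAt 𝓘(ℂ, E) 𝓘(ℂ, E) (chartAt E x₀).symm w :=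
    mdifferentiableAt_atlas_symm (chart_mem_atlas E x₀) hw
  ext v
  have e : (fun i => mfderiv 𝓘(ℝ, E) 𝓘(ℝ, E) (chartAt E x₀).symm w (J w (v i))) =
      fun i => J ((chartAt E x₀).symm w) (mfderiv 𝓘(ℝ, E) 𝓘(ℝ, E) (chartAt E x₀).symm w (v i)) :=
    funext fun i => mfderiv_J hs (v i)
  have := congrArg (fun u => (1 / 2 : ℂ) •
    (α ((chartAt E x₀).symm w) (fun i => mfderiv 𝓘(ℝ, E) 𝓘(ℝ, E) (chartAt E x₀).symm w (v i)) -
      Complex.I • α ((chartAt E x₀).symm w) u)) e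
  exact this.symm

/-- Smoothness of the `(1,0)`-part. The operator `J` is defined pointwise in varying preferred
charts, so this relies on the charts being holomorphic. -/
theorem Form.IsSmooth.part10 [IsManifold 𝓘(ℂ, E) ω X] {α : Form E X 1 ℂ} (hα : α.IsSmooth) :
    α.part10.IsSmooth := fun x₀ => by
  refine ContDiffOn.congr ?_ fun w hw => Form.inChart_part10 α x₀ hw
  have hJ : ContDiffOn ℝ ∞ (fun w => (α.inChart x₀ w).compContinuousLinearMap (mulI E))
      (chartAt E x₀).target :=
    (ContinuousAlternatingMap.compContinuousLinearMapCLM (𝕜 := ℝ) (F := ℂ) (ι := Fin 1)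
      (mulI E)).contDiff.comp_contDiffOn (hα x₀)
  exact (contDiff_const_smul (1 / 2 : ℂ)).comp_contDiffOn
    ((hα x₀).sub ((contDiff_const_smul Complex.I).comp_contDiffOn hJ))

theorem Form.IsSmooth.toComplex {k : ℕ} {α : Form E X k ℝ} (hα : α.IsSmooth) :
    α.toComplex.IsSmooth := fun x₀ =>
  (ContinuousLinearMap.compContinuousAlternatingMapCLM (𝕜 := ℝ) (E := E) (F := ℝ) (G := ℂ)
    (ι := Fin k) Complex.ofRealCLM).contDiff.comp_contDiffOn (hα x₀)

end ComplexStructure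

/-! ### The Hermitian forms on the holomorphic tangent space -/

section Levi

theorem alternating_swap {V F : Type*} [NormedAddCommGroup V] [NormedSpace ℝ V]
    [NormedAddCommGroup F] [NormedSpace ℝ F] (η : V [⋀^Fin 2]→L[ℝ] F) (u v : V) :
    η ![v, u] = -η ![u, v] := by
  have h := η.toAlternatingMap.map_swap ![u, v] (i := 0) (j := 1) (by decide)
  have e : ![u, v] ∘ Equiv.swap (0 : Fin 2) 1 = ![v, u] := by
    ext i; fin_cases i <;> rfl
  rw [e] at h
  exact h

theorem alternating_self {V F : Type*} [NormedAddCommGroup V] [NormedSpace ℝ V]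
    [NormedAddCommGroup F] [NormedSpace ℝ F] (η : V [⋀^Fin 2]→L[ℝ] F) (u : V) :
    η ![u, u] = 0 :=
  η.map_eq_zero_of_eq ![u, u] (i := 0) (j := 1) rfl (by decide)

theorem alternating_neg_left {V F : Type*} [NormedAddCommGroup V] [NormedSpace ℝ V]
    [NormedAddCommGroup F] [NormedSpace ℝ F] (η : V [⋀^Fin 2]→L[ℝ] F) (u v : V) :
    η ![-u, v] = -η ![u, v] := by
  have h := η.toMultilinearMap.cons_smul ![v] (-1 : ℝ) u
  rw [neg_one_smul, neg_one_smul] at h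
  exact h

theorem alternating_neg_right {V F : Type*} [NormedAddCommGroup V] [NormedSpace ℝ V]
    [NormedAddCommGroup F] [NormedSpace ℝ F] (η : V [⋀^Fin 2]→L[ℝ] F) (u v : V) :
    η ![u, -v] = -η ![u, v] := by
  rw [alternating_swap, alternating_neg_left, alternating_swap η u v, neg_neg]

variable {E : Type*} [NormedAddCommGroup E] [NormedSpace ℂ E]
  {X : Type*} [TopologicalSpace X] [ChartedSpace E X]
  {E' : Type*} [NormedAddCommGroup E'] [NormedSpace ℂ E']
  {Y : Type*} [TopologicalSpace Y] [ChartedSpace E' Y]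

/-- The diagonal value at `e - i J e ∈ T^{1,0} X` of the Hermitian form induced by `∂̄ α_{1,0}`.
For `α = du` it is, in a chart, `-(D²u(e, e) + D²u(ie, ie))`. -/
def levi (α : Form E X 1 ℝ) (x : X) (e : TangentSpace 𝓘(ℝ, E) x) : ℝ :=
  -2 * (α.toComplex.part10.d x ![e, J x e]).im

/-- Every vector of `T^{1,0}` has the form `e - i J e`. -/
theorem mem_T10_iff {x : X} (L : CTangent E x) : L ∈ T10 E x ↔ L = (L.1, -J x L.1) := by
  constructor
  · rintro ⟨h1, -⟩
    ext1
    · rfl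
    · exact (neg_eq_iff_eq_neg.2 h1).symm
  · intro h
    have h2 : L.2 = -J x L.1 := congrArg Prod.snd h
    refine ⟨by rw [h2, neg_neg], ?_⟩
    rw [h2, map_neg, J_J, neg_neg]

theorem Form.ceval_part11 (η : Form E X 2 ℂ) (x : X) (e : TangentSpace 𝓘(ℝ, E) x) :
    η.part11.ceval (x := x) (e, -J x e) (CTangent.conj (e, -J x e)) =
      2 * Complex.I * η x ![e, J x e] := by
  have h : ∀ u v : TangentSpace 𝓘(ℝ, E) x,
      η.part11 x ![u, v] = (1 / 2 : ℂ) * (η x ![u, v] + η x ![J x u, J x v]) := fun u v => by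
    have e2 : (fun i => J x (![u, v] i)) = ![J x u, J x v] := by
      ext i; fin_cases i <;> rfl
    have := congrArg (fun w => (1 / 2 : ℂ) * (η x ![u, v] + η x w)) e2
    exact this
  let η' : E [⋀^Fin 2]→L[ℝ] ℂ := η x
  have hs : ∀ u v : TangentSpace 𝓘(ℝ, E) x, η x ![v, u] = -η x ![u, v] :=
    fun u v => alternating_swap η' u v
  have h0 : ∀ u : TangentSpace 𝓘(ℝ, E) x, η x ![u, u] = 0 := fun u => alternating_self η' u
  have hl : ∀ u v : TangentSpace 𝓘(ℝ, E) x, η x ![-u, v] = -η x ![u, v] :=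
    fun u v => alternating_neg_left η' u v
  have hr : ∀ u v : TangentSpace 𝓘(ℝ, E) x, η x ![u, -v] = -η x ![u, v] :=
    fun u v => alternating_neg_right η' u v
  simp only [Form.ceval, CTangent.conj, h, neg_neg, map_neg, J_J, hl, hr, h0]
  rw [hs e (J x e)]
  ring

theorem ceval_wedge_part10_part01 (α : Form E X 1 ℝ) (x : X) (e : TangentSpace 𝓘(ℝ, E) x) :
    ((Form.wedge α.toComplex.part10 α.toComplex.part01).ceval (x := x) (e, -J x e)
      (CTangent.conj (e, -J x e))).re = α x ![e] ^ 2 + α x ![J x e] ^ 2 := by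
  have e2 : ∀ u : TangentSpace 𝓘(ℝ, E) x, (fun i => J x (![u] i)) = ![J x u] := fun u => by
    ext i; fin_cases i; rfl
  have hn : ∀ u : TangentSpace 𝓘(ℝ, E) x, α x ![-u] = -α x ![u] := fun u => by
    have h := (α x).toMultilinearMap.cons_smul ![] (-1 : ℝ) u
    rw [neg_one_smul, neg_one_smul] at h
    exact h
  have h10 : ∀ u : TangentSpace 𝓘(ℝ, E) x, α.toComplex.part10 x ![u] =
      (1 / 2 : ℂ) * ((α x ![u] : ℂ) - Complex.I * (α x ![J x u] : ℂ)) := fun u =>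
    congrArg (fun w => (1 / 2 : ℂ) * ((α x ![u] : ℂ) - Complex.I * (α x w : ℂ))) (e2 u)
  have h01 : ∀ u : TangentSpace 𝓘(ℝ, E) x, α.toComplex.part01 x ![u] =
      (1 / 2 : ℂ) * ((α x ![u] : ℂ) + Complex.I * (α x ![J x u] : ℂ)) := fun u =>
    congrArg (fun w => (1 / 2 : ℂ) * ((α x ![u] : ℂ) + Complex.I * (α x w : ℂ))) (e2 u)
  simp only [Form.ceval, CTangent.conj, Form.wedge_apply, h10, h01, neg_neg, map_neg, J_J, hn]
  generalize α x ![e] = p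
  generalize α x ![J x e] = q
  simp [pow_two]
  ring

/-- The inequality defining `𝔫_{X,0}` as a family of real inequalities indexed by real tangent
vectors. -/
theorem hermitianLE_iff (α : Form E X 1 ℝ) (t : ℝ) :
    HermitianLE (Form.wedge α.toComplex.part10 α.toComplex.part01) (t • α.toComplex.part10.dbar) ↔
      ∀ (x : X) (e : TangentSpace 𝓘(ℝ, E) x),
        α x ![e] ^ 2 + α x ![J x e] ^ 2 ≤ t * levi α x e := by
  have hr : ∀ (x : X) (e : TangentSpace 𝓘(ℝ, E) x),
      ((t • α.toComplex.part10.dbar).ceval (x := x) (e, -J x e)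
        (CTangent.conj (e, -J x e))).re = t * levi α x e := fun x e => by
    have h1 : (t • α.toComplex.part10.dbar).ceval (x := x) (e, -J x e)
        (CTangent.conj (e, -J x e)) = t * α.toComplex.part10.dbar.ceval (x := x) (e, -J x e)
        (CTangent.conj (e, -J x e)) := by
      have hs : ∀ m, (t • α.toComplex.part10.dbar) x m =
        (t : ℂ) * α.toComplex.part10.dbar x m := fun m => Complex.real_smul
      simp only [Form.ceval, hs]
      ring
    rw [h1, Form.dbar, Form.ceval_part11, levi]
    simp
  constructor
  · intro h x e
    have := h x (e, -J x e) ((mem_T10_iff _).2 rfl)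
    rwa [ceval_wedge_part10_part01, hr] at this
  · intro h x L hL
    rw [(mem_T10_iff L).1 hL, ceval_wedge_part10_part01, hr]
    exact h x L.1

theorem normForm_eq (α : Form E X 1 ℝ) :
    normForm α = ⨅ (t : ℝ) (_ : 0 < t ∧ ∀ (x : X) (e : TangentSpace 𝓘(ℝ, E) x),
        α x ![e] ^ 2 + α x ![J x e] ^ 2 ≤ t * levi α x e), ENNReal.ofReal t := by
  simp only [normForm, hermitianLE_iff]

theorem levi_add [IsManifold 𝓘(ℂ, E) ω X] {α β : Form E X 1 ℝ} (hα : α.IsSmooth)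
    (hβ : β.IsSmooth) (x : X) (e : TangentSpace 𝓘(ℝ, E) x) :
    levi (α + β) x e = levi α x e + levi β x e := by
  have h : (α + β).toComplex.part10 = α.toComplex.part10 + β.toComplex.part10 := by
    funext x
    ext v
    change (1 / 2 : ℂ) * (((α x v + β x v : ℝ) : ℂ) -
        Complex.I * ((α x (J x ∘ v) + β x (J x ∘ v) : ℝ) : ℂ)) =
      (1 / 2 : ℂ) * ((α x v : ℂ) - Complex.I * (α x (J x ∘ v) : ℂ)) +
      (1 / 2 : ℂ) * ((β x v : ℂ) - Complex.I * (β x (J x ∘ v) : ℂ))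
    push_cast
    ring
  rw [levi, h, Form.d_add hα.toComplex.part10 hβ.toComplex.part10]
  change -2 * (α.toComplex.part10.d x ![e, J x e] + β.toComplex.part10.d x ![e, J x e]).im = _
  rw [Complex.add_im, mul_add]
  rfl

theorem levi_smul (c : ℝ) (α : Form E X 1 ℝ) (x : X) (e : TangentSpace 𝓘(ℝ, E) x) :
    levi (c • α) x e = c * levi α x e := by
  have h : (c • α).toComplex.part10 = c • α.toComplex.part10 := by
    funext x
    ext v
    change (1 / 2 : ℂ) * (((c * α x v : ℝ) : ℂ) - Complex.I * ((c * α x (J x ∘ v) : ℝ) : ℂ)) =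
      c • ((1 / 2 : ℂ) * ((α x v : ℂ) - Complex.I * (α x (J x ∘ v) : ℂ)))
    rw [Complex.real_smul]
    push_cast
    ring
  rw [levi, h, Form.d_smul]
  change -2 * (c • α.toComplex.part10.d x ![e, J x e]).im = _
  rw [Complex.smul_im, levi, smul_eq_mul]
  ring

theorem levi_pullback [IsManifold 𝓘(ℂ, E) ω X] [IsManifold 𝓘(ℂ, E') ω Y] {Φ : Y → X}
    (hΦ : ContMDiff 𝓘(ℂ, E') 𝓘(ℂ, E) ω Φ) {α : Form E X 1 ℝ} (hα : α.IsSmooth) (y : Y)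
    (e : TangentSpace 𝓘(ℝ, E') y) :
    levi (Form.pullback Φ α : Form E' Y 1 ℝ) y e =
      levi α (Φ y) (mfderiv 𝓘(ℝ, E') 𝓘(ℝ, E) Φ y e) := by
  have : IsManifold 𝓘(ℝ, E) ∞ X := isManifold_real
  have : IsManifold 𝓘(ℝ, E') ∞ Y := isManifold_real
  have hd : MDifferentiable 𝓘(ℂ, E') 𝓘(ℂ, E) Φ := hΦ.mdifferentiable (by simp)
  have h : (Form.pullback Φ α : Form E' Y 1 ℝ).toComplex.part10 =
      Form.pullback Φ α.toComplex.part10 := Form.part10_pullback hd α.toComplex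
  -- both the `(1,0)`-part and the exterior derivative commute with the pullback
  rw [levi, h, Form.d_pullback (contMDiff_real hΦ) hα.toComplex.part10]
  have e2 : (fun i => mfderiv 𝓘(ℝ, E') 𝓘(ℝ, E) Φ y (![e, J y e] i)) =
      ![mfderiv 𝓘(ℝ, E') 𝓘(ℝ, E) Φ y e, J (Φ y) (mfderiv 𝓘(ℝ, E') 𝓘(ℝ, E) Φ y e)] := by
    ext i; fin_cases i
    · rfl
    · exact mfderiv_J (hd y) e
  exact congrArg (fun w => -2 * (α.toComplex.part10.d (Φ y) w).im) e2

end Levi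

/-! ### Homogeneity, quasi-triangle inequality, functoriality -/

section Properties

variable {E : Type*} [NormedAddCommGroup E] [NormedSpace ℂ E]
  {X : Type*} [TopologicalSpace X] [ChartedSpace E X]
  {E' : Type*} [NormedAddCommGroup E'] [NormedSpace ℂ E']
  {Y : Type*} [TopologicalSpace Y] [ChartedSpace E' Y]

theorem normForm_zero : normForm (0 : Form E X 1 ℝ) = 0 := by
  rw [normForm_eq]
  refine le_antisymm (ENNReal.le_of_forall_pos_le_add fun ε hε _ => ?_) bot_le
  refine (iInf₂_le (ε : ℝ) ⟨hε, fun x e => ?_⟩).trans (by simp)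
  have h : levi (0 : Form E X 1 ℝ) x e = 0 := by
    simpa using levi_smul (0 : ℝ) (0 : Form E X 1 ℝ) x e
  rw [h]
  change (0 : ℝ) ^ 2 + (0 : ℝ) ^ 2 ≤ _
  norm_num

theorem normForm_smul_le {c : ℝ} (hc : 0 < c) (α : Form E X 1 ℝ) :
    normForm (c • α) ≤ ENNReal.ofReal c * normForm α := by
  rw [normForm_eq α, ENNReal.mul_iInf_of_ne (by simpa using hc) ENNReal.ofReal_ne_top]
  refine le_iInf fun t => ?_
  rw [ENNReal.mul_iInf_of_ne (by simpa using hc) ENNReal.ofReal_ne_top]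
  refine le_iInf fun ht => ?_
  rw [← ENNReal.ofReal_mul hc.le, normForm_eq]
  refine iInf₂_le (c * t) ⟨mul_pos hc ht.1, fun x e => ?_⟩
  rw [levi_smul]
  change (c * α x ![e]) ^ 2 + (c * α x ![J x e]) ^ 2 ≤ _
  nlinarith [mul_le_mul_of_nonneg_left (ht.2 x e) (sq_nonneg c)]

theorem normForm_add_le [IsManifold 𝓘(ℂ, E) ω X] {α β : Form E X 1 ℝ} (hα : α.IsSmooth)
    (hβ : β.IsSmooth) : normForm (α + β) ≤ 2 * max (normForm α) (normForm β) := by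
  rw [← not_lt]
  intro hlt
  have hlt2 : max (normForm α) (normForm β) < normForm (α + β) / 2 := by
    rw [ENNReal.lt_div_iff_mul_lt (by simp) (by simp), mul_comm]
    exact hlt
  obtain ⟨ha, hb⟩ := max_lt_iff.1 hlt2
  rw [normForm_eq α] at ha
  rw [normForm_eq β] at hb
  simp only [iInf_lt_iff] at ha hb
  obtain ⟨s, ⟨hs0, hs⟩, hs'⟩ := ha
  obtain ⟨t, ⟨ht0, ht⟩, ht'⟩ := hb
  have hle : normForm (α + β) ≤ ENNReal.ofReal (2 * max s t) := by
    rw [normForm_eq]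
    refine iInf₂_le (2 * max s t) ⟨by positivity, fun x e => ?_⟩
    rw [levi_add hα hβ]
    change (α x ![e] + β x ![e]) ^ 2 + (α x ![J x e] + β x ![J x e]) ^ 2 ≤ _
    have h1 := hs x e
    have h2 := ht x e
    -- the Levi forms are nonnegative, so both inequalities persist with the larger constant
    have p1 : 0 ≤ levi α x e := by
      refine nonneg_of_mul_nonneg_right (le_trans ?_ h1) hs0; positivity
    have p2 : 0 ≤ levi β x e := by
      refine nonneg_of_mul_nonneg_right (le_trans ?_ h2) ht0; positivity
    have q1 := mul_le_mul_of_nonneg_right (le_max_left s t) p1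
    have q2 := mul_le_mul_of_nonneg_right (le_max_right s t) p2
    nlinarith [sq_nonneg (α x ![e] - β x ![e]), sq_nonneg (α x ![J x e] - β x ![J x e])]
  have hm : ENNReal.ofReal (max s t) < normForm (α + β) / 2 := by
    rcases max_choice s t with h | h <;> rw [h] <;> assumption
  rw [ENNReal.lt_div_iff_mul_lt (by simp) (by simp), mul_comm] at hm
  rw [ENNReal.ofReal_mul (by norm_num)] at hle
  simp only [ENNReal.ofReal_ofNat] at hle
  exact absurd hle (not_le.2 hm)

theorem normForm_pullback_le [IsManifold 𝓘(ℂ, E) ω X] [IsManifold 𝓘(ℂ, E') ω Y] {Φ : Y → X}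
    (hΦ : ContMDiff 𝓘(ℂ, E') 𝓘(ℂ, E) ω Φ) {α : Form E X 1 ℝ} (hα : α.IsSmooth) :
    normForm (Form.pullback Φ α : Form E' Y 1 ℝ) ≤ normForm α := by
  rw [normForm_eq α, normForm_eq]
  refine le_iInf₂ fun t ht => iInf₂_le t ⟨ht.1, fun y e => ?_⟩
  rw [levi_pullback hΦ hα]
  have h := ht.2 (Φ y) (mfderiv 𝓘(ℝ, E') 𝓘(ℝ, E) Φ y e)
  rw [← mfderiv_J (hΦ.mdifferentiable (by simp) y) e] at h
  have e2 : ∀ u : TangentSpace 𝓘(ℝ, E') y, (fun i => mfderiv 𝓘(ℝ, E') 𝓘(ℝ, E) Φ y (![u] i)) =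
      ![mfderiv 𝓘(ℝ, E') 𝓘(ℝ, E) Φ y u] := fun u => by
    ext i; fin_cases i; rfl
  have e3 : ∀ u : TangentSpace 𝓘(ℝ, E') y, (Form.pullback Φ α : Form E' Y 1 ℝ) y ![u] =
      α (Φ y) ![mfderiv 𝓘(ℝ, E') 𝓘(ℝ, E) Φ y u] := fun u => congrArg (α (Φ y)) (e2 u)
  rw [e3, e3]
  exact h

theorem normClass_zero : normClass (0 : DeRhamH1 E X) = 0 :=
  le_antisymm ((iInf₂_le (f := fun (β : closedForms E X) (_ : deRhamClass β = 0) => normForm β.1)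
    0 (map_zero _)).trans normForm_zero.le) bot_le

theorem normClass_smul_le {t : ℝ} (ht : 0 < t) (c : DeRhamH1 E X) :
    normClass (t • c) ≤ ENNReal.ofReal t * normClass c := by
  have h0 : ENNReal.ofReal t ≠ 0 := by simpa using ht
  rw [normClass.eq_def c, ENNReal.mul_iInf_of_ne h0 ENNReal.ofReal_ne_top]
  refine le_iInf fun β => ?_
  rw [ENNReal.mul_iInf_of_ne h0 ENNReal.ofReal_ne_top]
  refine le_iInf fun hβ => ?_
  refine (iInf₂_le (t • β) ?_).trans (normForm_smul_le ht β.1)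
  rw [← hβ]; exact map_smul _ _ _

theorem normClass_smul {t : ℝ} (ht : 0 ≤ t) (c : DeRhamH1 E X) :
    normClass (t • c) = ENNReal.ofReal t * normClass c := by
  rcases ht.eq_or_lt with rfl | ht
  · rw [zero_smul, normClass_zero, ENNReal.ofReal_zero, zero_mul]
  refine le_antisymm (normClass_smul_le ht c) ?_
  have h := normClass_smul_le (inv_pos.2 ht) (t • c)
  rw [inv_smul_smul₀ ht.ne'] at h
  calc ENNReal.ofReal t * normClass c
      ≤ ENNReal.ofReal t * (ENNReal.ofReal t⁻¹ * normClass (t • c)) := by gcongr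
    _ = normClass (t • c) := by
      rw [← mul_assoc, ← ENNReal.ofReal_mul ht.le, mul_inv_cancel₀ ht.ne', ENNReal.ofReal_one,
        one_mul]

theorem normClass_add_le [IsManifold 𝓘(ℂ, E) ω X] (a b : DeRhamH1 E X) :
    normClass (a + b) ≤ 2 * max (normClass a) (normClass b) := by
  rw [← not_lt]
  intro hlt
  have hlt2 : max (normClass a) (normClass b) < normClass (a + b) / 2 := by
    rw [ENNReal.lt_div_iff_mul_lt (by simp) (by simp), mul_comm]
    exact hlt
  obtain ⟨ha, hb⟩ := max_lt_iff.1 hlt2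
  rw [normClass.eq_def a] at ha
  rw [normClass.eq_def b] at hb
  simp only [iInf_lt_iff] at ha hb
  obtain ⟨α, hα, hα'⟩ := ha
  obtain ⟨β, hβ, hβ'⟩ := hb
  have h1 : normClass (a + b) ≤ normForm (α.1 + β.1) :=
    iInf₂_le (f := fun (γ : closedForms E X) (_ : deRhamClass γ = a + b) => normForm γ.1) (α + β)
      (by rw [← hα, ← hβ]; exact map_add _ _ _)
  have h2 := h1.trans (normForm_add_le α.2.1 β.2.1)
  have hm := max_lt hα' hβ'
  rw [ENNReal.lt_div_iff_mul_lt (by simp) (by simp), mul_comm] at hm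
  exact absurd h2 (not_le.2 hm)

theorem normClass_holPullback_le [IsManifold 𝓘(ℂ, E) ω X] [IsManifold 𝓘(ℂ, E') ω Y] (Φ : Y → X)
    (hΦ : ContMDiff 𝓘(ℂ, E') 𝓘(ℂ, E) ω Φ) (c : DeRhamH1 E X) :
    normClass (holPullback Φ hΦ c) ≤ normClass c := by
  have : IsManifold 𝓘(ℝ, E) ∞ X := isManifold_real
  have : IsManifold 𝓘(ℝ, E') ∞ Y := isManifold_real
  refine le_iInf₂ fun β hβ => ?_
  refine (iInf₂_le (pullbackClosed Φ (contMDiff_real hΦ) β) ?_).trans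
    (normForm_pullback_le hΦ β.2.1)
  rw [← hβ]
  rfl

end Properties

/-! ### Energy estimate -/

section Energy

open MeasureTheory Filter Set Topology Metric

variable {V : Type*} [NormedAddCommGroup V] [NormedSpace ℝ V] [FiniteDimensional ℝ V]
  [MeasurableSpace V] [BorelSpace V] {μ : Measure V} [μ.IsAddHaarMeasure]

theorem continuous_mul_of_tsupport_subset {V : Type*} [TopologicalSpace V] {f g : V → ℝ}
    {U : Set V} (hU : IsOpen U)
    (hf : Continuous f) (hfU : tsupport f ⊆ U) (hg : ContinuousOn g U) :
    Continuous fun y => f y * g y := by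
  refine continuous_of_tsupport fun x hx => ?_
  have hx' : x ∈ U := hfU (tsupport_mul_subset_left hx)
  exact hf.continuousAt.mul (hg.continuousAt (hU.mem_nhds hx'))

theorem integrable_mul_of_tsupport_subset {V : Type*} [TopologicalSpace V] [MeasurableSpace V]
    [OpensMeasurableSpace V] {μ : Measure V} [IsFiniteMeasureOnCompacts μ] {f g : V → ℝ}
    {U : Set V} (hU : IsOpen U)
    (hf : Continuous f) (hfc : HasCompactSupport f) (hfU : tsupport f ⊆ U)
    (hg : ContinuousOn g U) : Integrable (fun y => f y * g y) μ :=
  (continuous_mul_of_tsupport_subset hU hf hfU hg).integrable_of_hasCompactSupport hfc.mul_right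

theorem integral_sq_mul_fderiv {χ p : V → ℝ} {U : Set V} (hU : IsOpen U) (hχ : ContDiff ℝ ∞ χ)
    (hχc : HasCompactSupport χ) (hχU : tsupport χ ⊆ U) (hp : ContDiffOn ℝ 1 p U) (v : V) :
    ∫ y, χ y ^ 2 * fderiv ℝ p y v ∂μ = -∫ y, 2 * χ y * fderiv ℝ χ y v * p y ∂μ := by
  have hd : ∀ y, fderiv ℝ (fun y => χ y ^ 2) y v = 2 * χ y * fderiv ℝ χ y v := fun y => by
    have := ((hχ.differentiable (by simp)) y).hasFDerivAt.pow 2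
    rw [this.fderiv]
    simp
  have hsq : ContDiff ℝ ∞ fun y => χ y ^ 2 := hχ.pow 2
  have hsqc : HasCompactSupport fun y => χ y ^ 2 := by
    simp only [pow_two]; exact hχc.mul_right
  have hsqU : tsupport (fun y => χ y ^ 2) ⊆ U := by
    simp only [pow_two]; exact (tsupport_mul_subset_left).trans hχU
  have hcd : Continuous fun y => fderiv ℝ χ y v :=
    (hχ.continuous_fderiv (by simp)).clm_apply continuous_const
  have hp' : ContinuousOn (fun y => fderiv ℝ p y v) U :=
    (hp.continuousOn_fderiv_of_isOpen hU le_rfl).clm_apply continuousOn_const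
  have h := integral_mul_fderiv_eq_neg_fderiv_mul_of_integrable (μ := μ)
    (f := fun y => χ y ^ 2) (g := p) (v := v) ?_
    (integrable_mul_of_tsupport_subset hU hsq.continuous hsqc hsqU hp')
    (integrable_mul_of_tsupport_subset hU hsq.continuous hsqc hsqU hp.continuousOn)
    (fun x _ => hsq.differentiable (by simp) x)
    (fun x hx => (hp.differentiableOn one_ne_zero).differentiableAt (hU.mem_nhds (hsqU hx)))
  · simp only [hd] at h; exact h
  · simp only [hd]
    refine integrable_mul_of_tsupport_subset hU ((continuous_const.mul hχ.continuous).mul hcd)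
      (hχc.mul_left.mul_right) ?_ hp.continuousOn
    exact (tsupport_mul_subset_left).trans ((tsupport_mul_subset_right).trans hχU)

/-- The energy estimate. If a vector field with components `p`, `q` in the directions `v₁`, `v₂`
satisfies `|(p, q)|² ≤ -t div (p, q)`, its `L²` norm is locally `O(t)`: multiply by `χ²`, integrate
by parts, and absorb. -/
theorem energy_estimate {χ p q : V → ℝ} {U : Set V} (hU : IsOpen U) (hχ : ContDiff ℝ ∞ χ)
    (hχc : HasCompactSupport χ) (hχU : tsupport χ ⊆ U) (hp : ContDiffOn ℝ 1 p U)
    (hq : ContDiffOn ℝ 1 q U) {v₁ v₂ : V} {t : ℝ}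
    (h : ∀ y ∈ U, p y ^ 2 + q y ^ 2 ≤ -t * (fderiv ℝ p y v₁ + fderiv ℝ q y v₂)) :
    ∫ y, χ y ^ 2 * p y ^ 2 ∂μ ≤
      t ^ 2 * (4 * ∫ y, ((fderiv ℝ χ y v₁) ^ 2 + (fderiv ℝ χ y v₂) ^ 2) ∂μ) := by
  have hcd : ∀ v, Continuous fun y => fderiv ℝ χ y v := fun v =>
    (hχ.continuous_fderiv (by simp)).clm_apply continuous_const
  have hsq : Continuous fun y => χ y ^ 2 := hχ.continuous.pow 2
  have hsqc : HasCompactSupport fun y => χ y ^ 2 := by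
    simp only [pow_two]; exact hχc.mul_right
  have hsqU : tsupport (fun y => χ y ^ 2) ⊆ U := by
    simp only [pow_two]; exact (tsupport_mul_subset_left).trans hχU
  have hderiv : ∀ {p : V → ℝ}, ContDiffOn ℝ 1 p U → ∀ v,
      ContinuousOn (fun y => fderiv ℝ p y v) U := fun hp v =>
    (hp.continuousOn_fderiv_of_isOpen hU le_rfl).clm_apply continuousOn_const
  have hi : ∀ {g : V → ℝ}, ContinuousOn g U → Integrable (fun y => χ y ^ 2 * g y) μ :=
    fun hg => integrable_mul_of_tsupport_subset hU hsq hsqc hsqU hg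
  have hc : ∀ {p : V → ℝ}, ContDiffOn ℝ 1 p U → ∀ v,
      Integrable (fun y => 2 * χ y * fderiv ℝ χ y v * p y) μ := fun hp v =>
    integrable_mul_of_tsupport_subset hU ((continuous_const.mul hχ.continuous).mul (hcd v))
      (hχc.mul_left.mul_right)
      ((tsupport_mul_subset_left).trans ((tsupport_mul_subset_right).trans hχU)) hp.continuousOn
  have hdd : ∀ v, Integrable (fun y => (fderiv ℝ χ y v) ^ 2) μ := fun v => by
    refine ((hcd v).pow 2).integrable_of_hasCompactSupport ?_
    simp only [pow_two]
    exact (hχc.fderiv_apply (𝕜 := ℝ) v).mul_right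
  have hDi : Integrable (fun y => (fderiv ℝ χ y v₁) ^ 2 + (fderiv ℝ χ y v₂) ^ 2) μ :=
    (hdd v₁).add (hdd v₂)
  set T : ℝ := ∫ y, χ y ^ 2 * (p y ^ 2 + q y ^ 2) ∂μ with hT
  have hTi : Integrable (fun y => χ y ^ 2 * (p y ^ 2 + q y ^ 2)) μ :=
    hi ((hp.continuousOn.pow 2).add (hq.continuousOn.pow 2))
  have h1 : T ≤ t * ((∫ y, 2 * χ y * fderiv ℝ χ y v₁ * p y ∂μ) +
      ∫ y, 2 * χ y * fderiv ℝ χ y v₂ * q y ∂μ) := by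
    have e1 := integral_sq_mul_fderiv (μ := μ) hU hχ hχc hχU hp v₁
    have e2 := integral_sq_mul_fderiv (μ := μ) hU hχ hχc hχU hq v₂
    have e3 : ∫ y, -t * (χ y ^ 2 * fderiv ℝ p y v₁ + χ y ^ 2 * fderiv ℝ q y v₂) ∂μ =
        t * ((∫ y, 2 * χ y * fderiv ℝ χ y v₁ * p y ∂μ) +
          ∫ y, 2 * χ y * fderiv ℝ χ y v₂ * q y ∂μ) := by
      rw [integral_const_mul, integral_add (hi (hderiv hp v₁)) (hi (hderiv hq v₂)), e1, e2]
      ring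
    rw [← e3]
    refine integral_mono hTi (((hi (hderiv hp v₁)).add (hi (hderiv hq v₂))).const_mul _) fun y => ?_
    by_cases hy : y ∈ U
    · have := mul_le_mul_of_nonneg_left (h y hy) (sq_nonneg (χ y))
      simp only
      linarith
    · have : χ y = 0 := image_eq_zero_of_notMem_tsupport fun h' => hy (hχU h')
      simp [this]
  -- absorption: `2 t χ ∂χ p ≤ χ² p² / 2 + 2 t² (∂χ)²`
  have h2 : t * ((∫ y, 2 * χ y * fderiv ℝ χ y v₁ * p y ∂μ) +
      ∫ y, 2 * χ y * fderiv ℝ χ y v₂ * q y ∂μ) ≤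
      (1 / 2) * T + 2 * t ^ 2 * ∫ y, ((fderiv ℝ χ y v₁) ^ 2 + (fderiv ℝ χ y v₂) ^ 2) ∂μ := by
    rw [← integral_add (hc hp v₁) (hc hq v₂), hT, ← integral_const_mul, ← integral_const_mul,
      ← integral_const_mul, ← integral_add (hTi.const_mul _) (hDi.const_mul _)]
    refine integral_mono (((hc hp v₁).add (hc hq v₂)).const_mul _)
      ((hTi.const_mul _).add (hDi.const_mul _)) fun y => ?_
    simp only
    nlinarith [sq_nonneg (χ y * p y - 2 * t * fderiv ℝ χ y v₁),
      sq_nonneg (χ y * q y - 2 * t * fderiv ℝ χ y v₂)]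
  have h3 : ∫ y, χ y ^ 2 * p y ^ 2 ∂μ ≤ T := by
    refine integral_mono (hi (hp.continuousOn.pow 2)) hTi fun y => ?_
    simp only
    have := mul_nonneg (sq_nonneg (χ y)) (sq_nonneg (q y))
    linarith
  linarith

/-- The `L¹` form of the energy estimate, with the same linear dependence on `t`. -/
theorem lintegral_enorm_le_of_energy {χ p q : V → ℝ} {U K : Set V} (hU : IsOpen U)
    (hχ : ContDiff ℝ ∞ χ) (hχc : HasCompactSupport χ) (hχU : tsupport χ ⊆ U)
    (hK : MeasurableSet K) (hχK : ∀ y ∈ K, χ y = 1) (hp : ContDiffOn ℝ 1 p U)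
    (hq : ContDiffOn ℝ 1 q U) {v₁ v₂ : V} {t : ℝ} (ht : 0 < t)
    (h : ∀ y ∈ U, p y ^ 2 + q y ^ 2 ≤ -t * (fderiv ℝ p y v₁ + fderiv ℝ q y v₂)) :
    ∫⁻ y in K, ‖p y‖ₑ ∂μ ≤ ENNReal.ofReal (t * (2 * (∫ y, ((fderiv ℝ χ y v₁) ^ 2 +
      (fderiv ℝ χ y v₂) ^ 2) ∂μ) + 1 / 2 * ∫ y, χ y ^ 2 ∂μ)) := by
  have hsq : Continuous fun y => χ y ^ 2 := hχ.continuous.pow 2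
  have hsqc : HasCompactSupport fun y => χ y ^ 2 := by
    simp only [pow_two]; exact hχc.mul_right
  have hsqU : tsupport (fun y => χ y ^ 2) ⊆ U := by
    simp only [pow_two]; exact (tsupport_mul_subset_left).trans hχU
  have hi1 : Integrable (fun y => χ y ^ 2 * p y ^ 2) μ :=
    integrable_mul_of_tsupport_subset hU hsq hsqc hsqU (hp.continuousOn.pow 2)
  have hi2 : Integrable (fun y => χ y ^ 2) μ := hsq.integrable_of_hasCompactSupport hsqc
  have hi : Integrable (fun y => 1 / (2 * t) * (χ y ^ 2 * p y ^ 2) + t / 2 * χ y ^ 2) μ :=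
    (hi1.const_mul _).add (hi2.const_mul _)
  calc ∫⁻ y in K, ‖p y‖ₑ ∂μ
      ≤ ∫⁻ y in K, ENNReal.ofReal (1 / (2 * t) * (χ y ^ 2 * p y ^ 2) + t / 2 * χ y ^ 2) ∂μ := by
        refine setLIntegral_mono' hK fun y hy => ?_
        rw [Real.enorm_eq_ofReal_abs]
        refine ENNReal.ofReal_le_ofReal ?_
        -- `2 |p| ≤ p² / t + t`; this weight keeps the bound linear in `t`
        rw [hχK y hy, ← sq_abs (p y)]
        have e : 1 / (2 * t) * (1 ^ 2 * |p y| ^ 2) + t / 2 * 1 ^ 2 - |p y| =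
            (|p y| - t) ^ 2 / (2 * t) := by
          field_simp; ring
        have : 0 ≤ (|p y| - t) ^ 2 / (2 * t) := by positivity
        linarith
    _ ≤ ∫⁻ y, ENNReal.ofReal (1 / (2 * t) * (χ y ^ 2 * p y ^ 2) + t / 2 * χ y ^ 2) ∂μ :=
        setLIntegral_le_lintegral _ _
    _ = ENNReal.ofReal (∫ y, (1 / (2 * t) * (χ y ^ 2 * p y ^ 2) + t / 2 * χ y ^ 2) ∂μ) := by
        rw [ofReal_integral_eq_lintegral_ofReal hi]
        exact Eventually.of_forall fun y => by simp only [Pi.zero_apply]; positivity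
    _ ≤ _ := by
        refine ENNReal.ofReal_le_ofReal ?_
        rw [integral_add (hi1.const_mul _) (hi2.const_mul _), integral_const_mul,
          integral_const_mul]
        have := energy_estimate (μ := μ) hU hχ hχc hχU hp hq h
        have h4 := mul_le_mul_of_nonneg_left this (show 0 ≤ 1 / (2 * t) by positivity)
        have e : ∀ D : ℝ, 1 / (2 * t) * (t ^ 2 * (4 * D)) = t * (2 * D) := fun D => by
          field_simp; ring
        rw [e] at h4
        linarith

end Energy

/-! ### Almost everywhere convergence on balls -/

section Convergence

open MeasureTheory Filter Set Topology Metric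

variable {V : Type*} [NormedAddCommGroup V] [NormedSpace ℝ V] [FiniteDimensional ℝ V]
  [MeasurableSpace V] [BorelSpace V] {μ : Measure V} [μ.IsAddHaarMeasure]

theorem enorm_sub_le_lintegral_segment {V : Type*} [NormedAddCommGroup V] [NormedSpace ℝ V]
    {w : V → ℝ} {B : Set V} (hB : IsOpen B)
    (hBc : Convex ℝ B) (hw : ContDiffOn ℝ 1 w B) {x v : V} (hx : x ∈ B) (hxv : x + v ∈ B) :
    ‖w (x + v) - w x‖ₑ ≤ ∫⁻ t in Icc (0 : ℝ) 1, ‖fderiv ℝ w (x + t • v) v‖ₑ := by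
  have hmem : ∀ t ∈ Icc (0 : ℝ) 1, x + t • v ∈ B := fun t ht =>
    hBc.add_smul_mem hx hxv ht
  have hcont : ContinuousOn (fun t : ℝ => fderiv ℝ w (x + t • v) v) (Icc 0 1) := by
    refine ContinuousOn.clm_apply ?_ continuousOn_const
    exact (hw.continuousOn_fderiv_of_isOpen hB le_rfl).comp (by fun_prop) hmem
  have hder : ∀ t ∈ uIcc (0 : ℝ) 1,
      HasDerivAt (fun t : ℝ => w (x + t • v)) (fderiv ℝ w (x + t • v) v) t := by
    intro t ht
    rw [uIcc_of_le zero_le_one] at ht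
    have h1 : HasFDerivAt w (fderiv ℝ w (x + t • v)) (x + t • v) :=
      ((hw.differentiableOn one_ne_zero).differentiableAt (hB.mem_nhds (hmem t ht))).hasFDerivAt
    have h2 : HasDerivAt (fun t : ℝ => x + t • v) v t := by
      simpa using ((hasDerivAt_id t).smul_const v).const_add x
    exact h1.comp_hasDerivAt t h2
  have hint := intervalIntegral.integral_eq_sub_of_hasDerivAt hder
    (hcont.mono (by rw [uIcc_of_le zero_le_one])).intervalIntegrable
  simp only [one_smul, zero_smul, add_zero] at hint
  rw [← hint, intervalIntegral.integral_of_le zero_le_one, ← integral_Icc_eq_integral_Ioc]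
  exact enorm_integral_le_lintegral_enorm _

/-- If the derivatives of the `w k` in the direction `v` are summable in `L¹`, then the increments
`w k (x + v) - w k x` tend to zero for almost every `x`. -/
theorem ae_tendsto_increment {w : ℕ → V → ℝ} {B : Set V} (hB : IsOpen B)
    (hBc : Convex ℝ B) (hw : ∀ k, ContDiffOn ℝ 1 (w k) B) {v : V}
    (hsum : ∑' k, ∫⁻ y in B, ‖fderiv ℝ (w k) y v‖ₑ ∂μ ≠ ⊤) :
    ∀ᵐ x ∂μ, x ∈ B → x + v ∈ B → Tendsto (fun k => w k (x + v) - w k x) atTop (𝓝 0) := by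
  let G : ℕ → V → ENNReal := fun k => B.indicator fun y => ‖fderiv ℝ (w k) y v‖ₑ
  have hGm : ∀ k, Measurable (G k) := fun k =>
    (((measurable_fderiv_apply_const ℝ (w k) v).enorm).indicator hB.measurableSet)
  have hcomp : ∀ k, Measurable (fun z : V × ℝ => G k (z.1 + z.2 • v)) := fun k =>
    (hGm k).comp (by fun_prop)
  have hI : ∫⁻ x, ∑' k, ∫⁻ t in Icc (0 : ℝ) 1, G k (x + t • v) ∂volume ∂μ ≠ ⊤ := by
    -- for each `t` the integral over `x` is unchanged by the translation by `t • v`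
    have hk : ∀ k, ∫⁻ x, ∫⁻ t in Icc (0 : ℝ) 1, G k (x + t • v) ∂volume ∂μ =
        ∫⁻ y in B, ‖fderiv ℝ (w k) y v‖ₑ ∂μ := fun k => by
      rw [lintegral_lintegral_swap (hcomp k).aemeasurable]
      have : ∀ t : ℝ, ∫⁻ x, G k (x + t • v) ∂μ = ∫⁻ y in B, ‖fderiv ℝ (w k) y v‖ₑ ∂μ := fun t => by
        rw [lintegral_add_right_eq_self (G k) (t • v), lintegral_indicator hB.measurableSet]
      simp only [this, lintegral_const, Measure.restrict_apply MeasurableSet.univ, univ_inter,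
        Real.volume_Icc, sub_zero, ENNReal.ofReal_one, mul_one]
    rw [lintegral_tsum fun k => (Measurable.lintegral_prod_right' (hcomp k)).aemeasurable]
    simpa only [hk] using hsum
  have hae := ae_lt_top' (Measurable.aemeasurable (Measurable.tsum fun k =>
    Measurable.lintegral_prod_right' (hcomp k))) hI
  filter_upwards [hae] with x hx hxB hxvB
  have hz := ENNReal.tendsto_atTop_zero_of_tsum_ne_top hx.ne
  refine tendsto_zero_iff_enorm_tendsto_zero.2 ?_
  refine tendsto_of_tendsto_of_tendsto_of_le_of_le tendsto_const_nhds hz (fun _ => bot_le)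
    fun k => ?_
  refine (enorm_sub_le_lintegral_segment hB hBc (hw k) hxB hxvB).trans (le_of_eq ?_)
  refine setLIntegral_congr_fun measurableSet_Icc fun t ht => ?_
  have : x + t • v ∈ B := hBc.add_smul_mem hxB hxvB ht
  exact (indicator_of_mem this fun y => ‖fderiv ℝ (w k) y v‖ₑ).symm

/-- Functions whose derivatives in every direction are summable in `L¹` of a ball converge almost
everywhere on a smaller ball, up to additive constants. -/
theorem exists_ae_tendsto_sub {w : ℕ → V → ℝ} {c : V} {r : ℝ} (hr : 0 < r)
    (hw : ∀ k, ContDiffOn ℝ 1 (w k) (ball c (3 * r)))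
    (hsum : ∀ v, ∑' k, ∫⁻ y in ball c (3 * r), ‖fderiv ℝ (w k) y v‖ₑ ∂μ ≠ ⊤) :
    ∃ p, ∀ᵐ y ∂μ, y ∈ ball c r → Tendsto (fun k => w k y - w k p) atTop (𝓝 0) := by
  classical
  let W : ℕ → V → ℝ := fun k => (ball c (3 * r)).piecewise (w k) 0
  have hWm : ∀ k, Measurable (W k) := fun k =>
    (hw k).continuousOn.measurable_piecewise continuousOn_const measurableSet_ball
  have hWeq : ∀ k, ∀ y ∈ ball c (3 * r), W k y = w k y := fun k y hy =>
    piecewise_eq_of_mem _ _ _ hy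
  have hsub : ball c r ⊆ ball c (3 * r) := ball_subset_ball (by linarith)
  -- the pairs `(x, v)` for which the increments do not tend to zero; the `w k` are replaced by
  -- globally measurable extensions so that `D` is measurable
  let D : Set (V × V) := {z | z.1 ∈ ball c r ∧ z.2 ∈ ball (0 : V) (2 * r)} ∩
    {z | Tendsto (fun k => W k (z.1 + z.2) - W k z.1) atTop (𝓝 0)}ᶜ
  have hDm : MeasurableSet D := by
    refine MeasurableSet.inter ?_ (MeasurableSet.compl ?_)
    · exact (measurable_fst measurableSet_ball).inter (measurable_snd measurableSet_ball)
    · exact measurableSet_tendsto (𝓝 0) fun k =>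
        ((hWm k).comp (by fun_prop)).sub ((hWm k).comp (by fun_prop))
  have hadd : ∀ x ∈ ball c r, ∀ v ∈ ball (0 : V) (2 * r), x + v ∈ ball c (3 * r) := by
    intro x hx v hv
    rw [mem_ball, dist_eq_norm] at hx
    rw [mem_ball_zero_iff] at hv
    rw [mem_ball, dist_eq_norm]
    calc ‖x + v - c‖ = ‖(x - c) + v‖ := by congr 1; abel
      _ ≤ ‖x - c‖ + ‖v‖ := norm_add_le _ _
      _ < 3 * r := by linarith
  have hD0 : (μ.prod μ) D = 0 := by
    rw [← Measure.prod_swap, Measure.map_apply measurable_swap hDm,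
      Measure.measure_prod_null (measurable_swap hDm)]
    refine Eventually.of_forall fun v => ?_
    have := ae_tendsto_increment (μ := μ) isOpen_ball (convex_ball c (3 * r)) hw (hsum v)
    refine measure_mono_null ?_ this
    rintro x ⟨⟨hx, hv⟩, hn⟩ hx'
    refine hn ?_
    have hxB := hsub hx
    have hxv := hadd x hx v hv
    refine (hx' hxB hxv).congr fun k => ?_
    exact congrArg₂ (· - ·) (hWeq k _ hxv).symm (hWeq k x hxB).symm
  have hslice := (Measure.measure_prod_null hDm).1 hD0
  -- a base point in the small ball for which almost every translation is good
  have hpos : 0 < μ (ball c r) := measure_ball_pos μ c hr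
  obtain ⟨p, hp, hpD⟩ : ∃ p ∈ ball c r, μ (Prod.mk p ⁻¹' D) = 0 := by
    by_contra hcon
    push Not at hcon
    refine hpos.ne' (measure_mono_null (fun x hx => ?_) hslice)
    exact hcon x hx
  refine ⟨p, ?_⟩
  have htr : μ ((fun y => -p + y) ⁻¹' (Prod.mk p ⁻¹' D)) = 0 := by
    rw [measure_preimage_add]; exact hpD
  refine measure_mono_null ?_ htr
  intro y hy
  simp only [mem_compl_iff, mem_ofPred_eq, Classical.not_imp] at hy
  obtain ⟨hyB, hyn⟩ := hy
  have hv : -p + y ∈ ball (0 : V) (2 * r) := by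
    rw [mem_ball, dist_eq_norm] at hp hyB
    rw [mem_ball_zero_iff]
    calc ‖-p + y‖ = ‖(y - c) - (p - c)‖ := by congr 1; abel
      _ ≤ ‖y - c‖ + ‖p - c‖ := norm_sub_le _ _
      _ < 2 * r := by linarith
  refine ⟨⟨hp, hv⟩, fun hT => hyn ?_⟩
  refine hT.congr fun k => ?_
  change W k (p + (-p + y)) - W k p = _
  rw [add_neg_cancel_left, hWeq k _ (hsub hyB), hWeq k _ (hsub hp)]

end Convergence

/-! ### Local primitives and local convergence -/

section LocalConvergence

open MeasureTheory Filter Set Topology Metric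

/-- The Poincaré lemma for `1`-forms on a convex set in a chart. -/
theorem Form.exists_primitive {E : Type*} [NormedAddCommGroup E] [NormedSpace ℝ E]
    {X : Type*} [TopologicalSpace X] [ChartedSpace E X] [IsManifold 𝓘(ℝ, E) ∞ X]
    {α : Form E X 1 ℝ} (hα : α.IsSmooth) (hd : α.d = 0) (x₀ : X) {B : Set E} (hB : IsOpen B)
    (hBc : Convex ℝ B) (hBt : B ⊆ (chartAt E x₀).target) :
    ∃ u : E → ℝ, ContDiffOn ℝ ∞ u B ∧ ∀ y ∈ B, α.inChart x₀ y =
      ContinuousAlternatingMap.ofSubsingleton ℝ E ℝ (0 : Fin 1) (fderiv ℝ u y) := by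
  let L := ContinuousAlternatingMap.ofSubsingletonLIE (𝕜 := ℝ) (E := E) (F := ℝ) (0 : Fin 1)
  let a : E → E →L[ℝ] ℝ := fun y => L.symm (α.inChart x₀ y)
  have hs : ContDiffOn ℝ ∞ (α.inChart x₀) B := (hα x₀).mono hBt
  have ha : ContDiffOn ℝ ∞ a B := L.symm.contDiff.comp_contDiffOn hs
  have hda : DifferentiableOn ℝ a B := ha.differentiableOn (by simp)
  have hav : ∀ y v, a y v = α.inChart x₀ y ![v] := fun y v => by
    refine congrArg (α.inChart x₀ y) ?_
    ext i; fin_cases i; rfl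
  have hsymm : ∀ y ∈ B, ∀ v v', fderiv ℝ a y v v' = fderiv ℝ a y v' v := by
    intro y hy v v'
    have h0 : extDeriv (α.inChart x₀) y ![v, v'] = 0 := by
      rw [← Form.inChart_d hα x₀ (hBt hy), hd, Form.inChart_zero]
      rfl
    have hdiff : DifferentiableAt ℝ (α.inChart x₀) y :=
      (hs.differentiableOn (by simp)).differentiableAt (hB.mem_nhds hy)
    rw [extDeriv_apply hdiff, Fin.sum_univ_two] at h0
    have e1 : Fin.removeNth 0 ![v, v'] = ![v'] := by ext i; fin_cases i; rfl
    have e2 : Fin.removeNth 1 ![v, v'] = ![v] := by ext i; fin_cases i; rfl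
    rw [e1, e2] at h0
    have e3 : ∀ v, (fun z => α.inChart x₀ z ![v]) = fun z => a z v := fun v =>
      funext fun z => (hav z v).symm
    rw [e3, e3] at h0
    have hd' := hda.differentiableAt (hB.mem_nhds hy)
    have e4 : ∀ v, fderiv ℝ (fun z => a z v) y = (fderiv ℝ a y).flip v := fun v =>
      (hd'.hasFDerivAt.clm_apply (hasFDerivAt_const v y)).fderiv.trans (by ext; simp)
    rw [e4, e4] at h0
    simp at h0
    linarith
  obtain ⟨u, hu⟩ := hBc.exists_forall_hasFDerivAt_of_fderiv_symmetric hB hda hsymm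
  refine ⟨u, ?_, fun y hy => ?_⟩
  · rw [contDiffOn_infty_iff_fderiv_of_isOpen hB]
    exact ⟨fun y hy => (hu y hy).differentiableAt.differentiableWithinAt,
      ha.congr fun y hy => (hu y hy).fderiv⟩
  · rw [(hu y hy).fderiv]
    exact (L.apply_symm_apply _).symm

variable {E : Type*} [NormedAddCommGroup E] [NormedSpace ℂ E]
  {X : Type*} [TopologicalSpace X] [ChartedSpace E X]

/-- In a chart, for `α = du`, the form `levi` is `-(D²u(v, v) + D²u(iv, iv))`. -/
theorem levi_inChart [IsManifold 𝓘(ℂ, E) ω X] {α : Form E X 1 ℝ} (hα : α.IsSmooth) (x₀ : X)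
    {w : E} (hw : w ∈ (chartAt E x₀).target) (v : E) :
    levi α ((chartAt E x₀).symm w) (mfderiv 𝓘(ℝ, E) 𝓘(ℝ, E) (chartAt E x₀).symm w v) =
      -(fderiv ℝ (fun y => α.inChart x₀ y ![v]) w v +
        fderiv ℝ (fun y => α.inChart x₀ y ![Complex.I • v]) w (Complex.I • v)) := by
  have : IsManifold 𝓘(ℝ, E) ∞ X := isManifold_real
  have hs : MDifferentiableAt 𝓘(ℂ, E) 𝓘(ℂ, E) (chartAt E x₀).symm w :=
    mdifferentiableAt_atlas_symm (chart_mem_atlas E x₀) hw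
  have hsm : α.toComplex.part10.IsSmooth := hα.toComplex.part10
  have e0 : (fun i => mfderiv 𝓘(ℝ, E) 𝓘(ℝ, E) (chartAt E x₀).symm w (![v, Complex.I • v] i)) =
      ![mfderiv 𝓘(ℝ, E) 𝓘(ℝ, E) (chartAt E x₀).symm w v,
        J ((chartAt E x₀).symm w) (mfderiv 𝓘(ℝ, E) 𝓘(ℝ, E) (chartAt E x₀).symm w v)] := by
    ext i; fin_cases i
    · rfl
    · exact mfderiv_J hs v
  have h1 : levi α ((chartAt E x₀).symm w) (mfderiv 𝓘(ℝ, E) 𝓘(ℝ, E) (chartAt E x₀).symm w v) =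
      -2 * (α.toComplex.part10.d.inChart x₀ w ![v, Complex.I • v]).im :=
    congrArg (fun m => -2 * (α.toComplex.part10.d ((chartAt E x₀).symm w) m).im) e0.symm
  rw [h1, Form.inChart_d hsm x₀ hw, extDeriv_apply (hsm.differentiableAt x₀ hw), Fin.sum_univ_two]
  have e1 : Fin.removeNth 0 ![v, Complex.I • v] = ![Complex.I • v] := by
    ext i; fin_cases i; rfl
  have e2 : Fin.removeNth 1 ![v, Complex.I • v] = ![v] := by ext i; fin_cases i; rfl
  rw [e1, e2]
  -- `Im α_{1,0}(u) = -α(i u) / 2` in the chart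
  have him : ∀ u u' : E, (fderiv ℝ (fun y => α.toComplex.part10.inChart x₀ y ![u]) w u').im =
      -(1 / 2) * fderiv ℝ (fun y => α.inChart x₀ y ![Complex.I • u]) w u' := by
    intro u u'
    have hd : DifferentiableAt ℝ (fun y => α.toComplex.part10.inChart x₀ y ![u]) w :=
      (ContinuousAlternatingMap.apply ℝ E ℂ ![u]).differentiableAt.comp w
        (hsm.differentiableAt x₀ hw)
    have hd2 : DifferentiableAt ℝ (fun y => α.inChart x₀ y ![Complex.I • u]) w :=
      (ContinuousAlternatingMap.apply ℝ E ℝ ![Complex.I • u]).differentiableAt.comp w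
        (hα.differentiableAt x₀ hw)
    have h2 : fderiv ℝ (fun y => (α.toComplex.part10.inChart x₀ y ![u]).im) w =
        Complex.imCLM ∘L fderiv ℝ (fun y => α.toComplex.part10.inChart x₀ y ![u]) w :=
      (Complex.imCLM.hasFDerivAt.comp w hd.hasFDerivAt).fderiv
    have h3 : (fun y => (α.toComplex.part10.inChart x₀ y ![u]).im) =ᶠ[𝓝 w]
        fun y => -(1 / 2) * α.inChart x₀ y ![Complex.I • u] := by
      filter_upwards [(chartAt E x₀).open_target.mem_nhds hw] with y hy
      rw [Form.inChart_part10 _ x₀ hy]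
      have e3 : (fun i => mulI E (![u] i)) = ![Complex.I • u] := by ext i; fin_cases i; rfl
      have h4 : (((1 / 2 : ℂ) • (α.toComplex.inChart x₀ y - Complex.I •
          (α.toComplex.inChart x₀ y).compContinuousLinearMap (mulI E))) ![u]) =
          (1 / 2 : ℂ) * ((α.inChart x₀ y ![u] : ℂ) -
            Complex.I * (α.inChart x₀ y ![Complex.I • u] : ℂ)) :=
        congrArg (fun m => (1 / 2 : ℂ) * ((α.inChart x₀ y ![u] : ℂ) -
            Complex.I * (α.inChart x₀ y m : ℂ))) e3
      rw [h4]
      simp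
    calc (fderiv ℝ (fun y => α.toComplex.part10.inChart x₀ y ![u]) w u').im
        = fderiv ℝ (fun y => (α.toComplex.part10.inChart x₀ y ![u]).im) w u' := by rw [h2]; rfl
      _ = _ := by
        rw [h3.fderiv_eq, fderiv_const_mul hd2]
        rfl
  have hneg : (fun y => α.inChart x₀ y ![Complex.I • Complex.I • v]) =
      fun y => -α.inChart x₀ y ![v] := by
    funext y
    have h := (α.inChart x₀ y).toMultilinearMap.cons_smul ![] (-1 : ℝ) v
    rw [neg_one_smul, neg_one_smul] at h
    rw [smul_smul, Complex.I_mul_I, neg_one_smul]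
    exact h
  have h5 := him (Complex.I • v) v
  have h6 := him v (Complex.I • v)
  rw [hneg, fderiv_fun_neg] at h5
  simp only [neg_apply] at h5
  simp only [Fin.val_zero, Fin.val_one, pow_zero, pow_one, one_smul, neg_smul, Complex.add_im,
    Complex.neg_im, Matrix.cons_val_zero, Matrix.cons_val_one, h5, h6]
  ring

/-- The inequality defining `𝔫_{X,0}`, read in a chart. -/
theorem sq_add_sq_le_inChart [IsManifold 𝓘(ℂ, E) ω X] {β : Form E X 1 ℝ} (hβ : β.IsSmooth) {t : ℝ}
    (h : ∀ (x : X) (e : TangentSpace 𝓘(ℝ, E) x), β x ![e] ^ 2 + β x ![J x e] ^ 2 ≤ t * levi β x e)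
    (x₀ : X) {w : E} (hw : w ∈ (chartAt E x₀).target) (v : E) :
    β.inChart x₀ w ![v] ^ 2 + β.inChart x₀ w ![Complex.I • v] ^ 2 ≤
      -t * (fderiv ℝ (fun y => β.inChart x₀ y ![v]) w v +
        fderiv ℝ (fun y => β.inChart x₀ y ![Complex.I • v]) w (Complex.I • v)) := by
  have hs : MDifferentiableAt 𝓘(ℂ, E) 𝓘(ℂ, E) (chartAt E x₀).symm w :=
    mdifferentiableAt_atlas_symm (chart_mem_atlas E x₀) hw
  have h1 := h ((chartAt E x₀).symm w) (mfderiv 𝓘(ℝ, E) 𝓘(ℝ, E) (chartAt E x₀).symm w v)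
  rw [levi_inChart hβ x₀ hw v, ← mfderiv_J hs v] at h1
  have e2 : ∀ u : E, (fun i => mfderiv 𝓘(ℝ, E) 𝓘(ℝ, E) (chartAt E x₀).symm w (![u] i)) =
      ![mfderiv 𝓘(ℝ, E) 𝓘(ℝ, E) (chartAt E x₀).symm w u] := fun u => by
    ext i; fin_cases i; rfl
  have e3 : ∀ u : E, β.inChart x₀ w ![u] =
      β ((chartAt E x₀).symm w) ![mfderiv 𝓘(ℝ, E) 𝓘(ℝ, E) (chartAt E x₀).symm w u] := fun u =>
    congrArg (β ((chartAt E x₀).symm w)) (e2 u)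
  rw [e3, e3, neg_mul, ← mul_neg]
  exact h1

variable [FiniteDimensional ℝ E] [MeasurableSpace E] [BorelSpace E] {μ : Measure E}
  [μ.IsAddHaarMeasure]

/-- If the forms `α + df k` satisfy the inequality defining `𝔫_{X,0}` with constants `t k ≤ 2⁻ᵏ`,
then near each point the `f k` converge almost everywhere, up to additive constants, to `-u`, where
`u` is a local primitive of `α`. -/
theorem exists_local_ae_tendsto [IsManifold 𝓘(ℂ, E) ω X] {α : Form E X 1 ℝ} (hα : α.IsSmooth)
    (hd : α.d = 0) {f : ℕ → X → ℝ} (hf : ∀ k, ContMDiff 𝓘(ℝ, E) 𝓘(ℝ, ℝ) ∞ (f k)) {t : ℕ → ℝ}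
    (ht : ∀ k, 0 < t k) (ht2 : ∀ k, t k ≤ (1 / 2) ^ k)
    (h : ∀ k (x : X) (e : TangentSpace 𝓘(ℝ, E) x), (α + dFun (f k) : Form E X 1 ℝ) x ![e] ^ 2 +
      (α + dFun (f k) : Form E X 1 ℝ) x ![J x e] ^ 2 ≤ t k * levi (α + dFun (f k)) x e) (x₀ : X) :
    ∃ r > 0, ∃ (u : E → ℝ) (c : ℕ → ℝ), ball (chartAt E x₀ x₀) r ⊆ (chartAt E x₀).target ∧
      ContDiffOn ℝ ∞ u (ball (chartAt E x₀ x₀) r) ∧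
      (∀ y ∈ ball (chartAt E x₀ x₀) r, α.inChart x₀ y =
        ContinuousAlternatingMap.ofSubsingleton ℝ E ℝ (0 : Fin 1) (fderiv ℝ u y)) ∧
      ∀ᵐ y ∂μ, y ∈ ball (chartAt E x₀ x₀) r →
        Tendsto (fun k => f k ((chartAt E x₀).symm y) + u y - c k) atTop (𝓝 0) := by
  have : IsManifold 𝓘(ℝ, E) ∞ X := isManifold_real
  obtain ⟨R, hR, hRt⟩ := Metric.mem_nhds_iff.1
    ((chartAt E x₀).open_target.mem_nhds (mem_chart_target E x₀))
  set x := chartAt E x₀ x₀ with hx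
  set r := R / 5 with hr
  have hr0 : 0 < r := by positivity
  have hsub3 : ball x (3 * r) ⊆ (chartAt E x₀).target :=
    (ball_subset_ball (by rw [hr]; linarith)).trans hRt
  have hsub1 : ball x r ⊆ ball x (3 * r) := ball_subset_ball (by linarith)
  obtain ⟨u, hu, hua⟩ := Form.exists_primitive hα hd x₀ isOpen_ball (convex_ball x (3 * r)) hsub3
  let w : ℕ → E → ℝ := fun k y => f k ((chartAt E x₀).symm y) + u y
  have hfs : ∀ k, ∀ y ∈ (chartAt E x₀).target,
      ContDiffAt ℝ ∞ (fun y => f k ((chartAt E x₀).symm y)) y := fun k y hy =>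
    contDiffAt_comp_chart (hf k) x₀ hy
  have hw : ∀ k, ContDiffOn ℝ 1 (w k) (ball x (3 * r)) := fun k => by
    refine ContDiffOn.of_le (n := ∞) ?_ (by simp)
    exact ContDiffOn.add (fun y hy => (hfs k y (hsub3 hy)).contDiffWithinAt) hu
  have hβ : ∀ k, (α + dFun (f k)).IsSmooth := fun k => hα.add (dFun_isSmooth (hf k))
  have hwd : ∀ k, ∀ y ∈ ball x (3 * r), ∀ v,
      fderiv ℝ (w k) y v = (α + dFun (f k)).inChart x₀ y ![v] := by
    intro k y hy v
    have e1 : (α + dFun (f k)).inChart x₀ y ![v] =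
        α.inChart x₀ y ![v] + (dFun (f k) : Form E X 1 ℝ).inChart x₀ y ![v] := by
      rw [Form.inChart_add]; rfl
    have e2 : fderiv ℝ (w k) y =
        fderiv ℝ (f k ∘ (chartAt E x₀).symm) y + fderiv ℝ u y :=
      fderiv_add ((hfs k y (hsub3 hy)).differentiableAt (by simp))
        ((hu.differentiableOn (by simp)).differentiableAt (isOpen_ball.mem_nhds hy))
    rw [e1, e2, hua y hy, dFun_inChart (hf k) x₀ (hsub3 hy), add_comm]
    rfl
  -- equal to `1` on the ball of radius `3 r`, supported in the closed ball of radius `4 r < R`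
  let χ : ContDiffBump x := ⟨3 * r, 4 * r, by positivity, by linarith⟩
  have hχU : tsupport χ ⊆ (chartAt E x₀).target := by
    rw [χ.tsupport_eq]
    exact (closedBall_subset_ball (by change 4 * r < R; rw [hr]; linarith)).trans hRt
  have hsum : ∀ v, ∑' k, ∫⁻ y in ball x (3 * r), ‖fderiv ℝ (w k) y v‖ₑ ∂μ ≠ ⊤ := by
    intro v
    set C := 2 * (∫ y, ((fderiv ℝ χ y v) ^ 2 + (fderiv ℝ χ y (Complex.I • v)) ^ 2) ∂μ) +
      1 / 2 * ∫ y, χ y ^ 2 ∂μ with hC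
    have hC0 : 0 ≤ C := by positivity
    have hk : ∀ k, ∫⁻ y in ball x (3 * r), ‖fderiv ℝ (w k) y v‖ₑ ∂μ ≤
        ENNReal.ofReal ((1 / 2) ^ k * C) := by
      intro k
      have hp : ∀ v, ContDiffOn ℝ 1 (fun y => (α + dFun (f k)).inChart x₀ y ![v])
          (chartAt E x₀).target := fun v =>
        ((ContinuousAlternatingMap.apply ℝ E ℝ ![v]).contDiff.comp_contDiffOn
          (hβ k x₀)).of_le (by simp)
      have := lintegral_enorm_le_of_energy (μ := μ) (K := ball x (3 * r))
        (chartAt E x₀).open_target χ.contDiff χ.hasCompactSupport hχU measurableSet_ball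
        (fun y hy => χ.one_of_mem_closedBall (ball_subset_closedBall hy)) (hp v)
        (hp (Complex.I • v)) (ht k)
        (fun y hy => sq_add_sq_le_inChart (hβ k) (h k) x₀ hy v)
      rw [setLIntegral_congr_fun measurableSet_ball fun y hy => by rw [hwd k y hy v]]
      exact this.trans (ENNReal.ofReal_le_ofReal (mul_le_mul_of_nonneg_right (ht2 k) hC0))
    refine ne_top_of_le_ne_top ?_ (ENNReal.tsum_le_tsum hk)
    exact ((summable_geometric_of_lt_one (by norm_num) (by norm_num)).mul_right C).tsum_ofReal_ne_top
  obtain ⟨p, hp⟩ := exists_ae_tendsto_sub (μ := μ) hr0 hw hsum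
  refine ⟨r, hr0, u, fun k => w k p, hsub1.trans hsub3, hu.mono hsub1,
    fun y hy => hua y (hsub1 hy), ?_⟩
  filter_upwards [hp] with y hy hyB
  exact hy hyB

end LocalConvergence

/-! ### Gluing local limits -/

section Gluing

open MeasureTheory Filter Set Topology Metric

variable {E : Type*} [NormedAddCommGroup E] [NormedSpace ℝ E] [FiniteDimensional ℝ E]
  [MeasurableSpace E] [BorelSpace E] {μ : Measure E} [μ.IsAddHaarMeasure]
  {X : Type*} [TopologicalSpace X] [ChartedSpace E X] [IsManifold 𝓘(ℝ, E) ∞ X]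

/-- Two properties holding almost everywhere in two charts hold simultaneously at some point of any
nonempty open set covered by both charts: coordinate changes are differentiable, so they preserve
null sets. -/
theorem exists_mem_of_ae_inChart (z z' : X) {P P' : X → Prop} {O : Set X} (hO : IsOpen O)
    (hne : O.Nonempty) (hz : O ⊆ (chartAt E z).source) (hz' : O ⊆ (chartAt E z').source)
    (hP : ∀ᵐ y ∂μ, y ∈ (chartAt E z).target → (chartAt E z).symm y ∈ O → P ((chartAt E z).symm y))
    (hP' : ∀ᵐ y ∂μ, y ∈ (chartAt E z').target → (chartAt E z').symm y ∈ O →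
      P' ((chartAt E z').symm y)) :
    ∃ x ∈ O, P x ∧ P' x := by
  let A : Set E := (chartAt E z) '' O
  have hA : IsOpen A := (chartAt E z).isOpen_image_of_subset_source hO hz
  have hApos : 0 < μ A := hA.measure_pos μ (hne.image _)
  let N' : Set E := {y | y ∈ chartAt E z' '' O ∧ ¬P' ((chartAt E z').symm y)}
  have hN' : μ N' = 0 := by
    refine measure_mono_null ?_ hP'
    rintro _ ⟨⟨x, hx, rfl⟩, hn⟩ h
    exact hn (h ((chartAt E z').map_source (hz' hx)) (by rwa [(chartAt E z').left_inv (hz' hx)]))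
  have hdiff : DifferentiableOn ℝ (coordMap (E := E) (E' := E) (id : X → X) z' z) N' := by
    rintro _ ⟨⟨x, hx, rfl⟩, -⟩
    refine ((coordMap_contDiffAt contMDiff_id z' z ((chartAt E z').map_source (hz' hx))
      ?_).differentiableAt (by simp)).differentiableWithinAt
    rw [(chartAt E z').left_inv (hz' hx)]
    exact hz hx
  have himg := addHaar_image_eq_zero_of_differentiableOn_of_addHaar_eq_zero μ hdiff hN'
  by_contra hcon
  push Not at hcon
  refine hApos.ne' (measure_mono_null ?_ (measure_union_null hP himg))
  rintro _ ⟨x, hx, rfl⟩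
  by_cases hPx : P x
  · refine Or.inr ⟨chartAt E z' x, ⟨mem_image_of_mem _ hx, ?_⟩, ?_⟩
    · rw [(chartAt E z').left_inv (hz' hx)]
      exact hcon x hx hPx
    · simp only [coordMap, Function.comp_apply, (chartAt E z').left_inv (hz' hx), id]
  · refine Or.inl fun h => hPx ?_
    have h' := h ((chartAt E z).map_source (hz hx))
    rw [(chartAt E z).left_inv (hz hx)] at h'
    exact h' hx

/-- A closed form `α` is exact if there are functions `f k` that near each point converge almost
everywhere, up to additive constants depending on `k`, to `-u`, with `u` a local primitive of
`α`. -/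
theorem mem_exactForms_of_local_ae_tendsto {α : Form E X 1 ℝ} {f : ℕ → X → ℝ}
    (h : ∀ x₀ : X, ∃ r > 0, ∃ (u : E → ℝ) (c : ℕ → ℝ),
      ball (chartAt E x₀ x₀) r ⊆ (chartAt E x₀).target ∧
      ContDiffOn ℝ ∞ u (ball (chartAt E x₀ x₀) r) ∧
      (∀ y ∈ ball (chartAt E x₀ x₀) r, α.inChart x₀ y =
        ContinuousAlternatingMap.ofSubsingleton ℝ E ℝ (0 : Fin 1) (fderiv ℝ u y)) ∧
      ∀ᵐ y ∂μ, y ∈ ball (chartAt E x₀ x₀) r →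
        Tendsto (fun k => f k ((chartAt E x₀).symm y) + u y - c k) atTop (𝓝 0)) :
    α ∈ exactForms E X := by
  choose r hr u c hrt hu hα hae using h
  let U : X → Set X := fun z => (chartAt E z).source ∩ chartAt E z ⁻¹' ball (chartAt E z z) (r z)
  have hUo : ∀ z, IsOpen (U z) := fun z =>
    (chartAt E z).isOpen_inter_preimage isOpen_ball
  have hUz : ∀ z, z ∈ U z := fun z => ⟨mem_chart_source E z, mem_ball_self (hr z)⟩
  have huc : ∀ z, ContinuousOn (fun x => u z (chartAt E z x)) (U z) := fun z =>
    (hu z).continuousOn.comp ((chartAt E z).continuousOn.mono inter_subset_left)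
      fun x hx => hx.2
  -- at a common good point the difference of the constants has a limit
  have hgood : ∀ z z' (O : Set X), IsOpen O → O.Nonempty → O ⊆ U z ∩ U z' → ∃ x ∈ O,
      Tendsto (fun k => c z' k - c z k) atTop
        (𝓝 (u z' (chartAt E z' x) - u z (chartAt E z x))) := by
    intro z z' O hO hne hOU
    have hP : ∀ z, O ⊆ U z → ∀ᵐ y ∂μ, y ∈ (chartAt E z).target →
        (chartAt E z).symm y ∈ O → Tendsto (fun k => f k ((chartAt E z).symm y) +
          u z (chartAt E z ((chartAt E z).symm y)) - c z k) atTop (𝓝 0) := by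
      intro z hOz
      filter_upwards [hae z] with y hy hyt hyO
      have hy' := (hOz hyO).2
      rw [mem_preimage, (chartAt E z).right_inv hyt] at hy'
      rw [(chartAt E z).right_inv hyt]
      exact hy hy'
    obtain ⟨x, hx, h1, h2⟩ := exists_mem_of_ae_inChart (μ := μ) z z'
      (P := fun x => Tendsto (fun k => f k x + u z (chartAt E z x) - c z k) atTop (𝓝 0))
      (P' := fun x => Tendsto (fun k => f k x + u z' (chartAt E z' x) - c z' k) atTop (𝓝 0)) hO hne
      (fun x hx => (hOU hx).1.1) (fun x hx => (hOU hx).2.1)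
      (hP z fun x hx => (hOU hx).1) (hP z' fun x hx => (hOU hx).2)
    refine ⟨x, hx, ?_⟩
    have h3 := (h1.sub h2).add_const (u z' (chartAt E z' x) - u z (chartAt E z x))
    rw [sub_zero, zero_add] at h3
    refine h3.congr fun k => ?_
    ring
  -- the limit is the difference of the local primitives, at every point of the overlap
  have hlim : ∀ z z' x, x ∈ U z ∩ U z' → Tendsto (fun k => c z' k - c z k) atTop
      (𝓝 (u z' (chartAt E z' x) - u z (chartAt E z x))) := by
    intro z z' x hx
    have hO := (hUo z).inter (hUo z')
    obtain ⟨y, -, hy⟩ := hgood z z' _ hO ⟨x, hx⟩ subset_rfl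
    by_contra hcon
    -- otherwise the transition function would miss the limit on a nonempty open set
    let g : X → ℝ := fun x => u z' (chartAt E z' x) - u z (chartAt E z x)
    have hg : ContinuousOn g (U z ∩ U z') :=
      ((huc z').mono inter_subset_right).sub ((huc z).mono inter_subset_left)
    have hO' : IsOpen ((U z ∩ U z') ∩ g ⁻¹' {g y}ᶜ) :=
      hg.isOpen_inter_preimage hO isOpen_compl_singleton
    have hxg : g x ≠ g y := fun he => hcon (by
      change Tendsto _ _ (𝓝 (g x))
      rw [he]; exact hy)
    obtain ⟨y', ⟨-, hy'⟩, hy'l⟩ := hgood z z' _ hO' ⟨x, hx, hxg⟩ inter_subset_left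
    exact hy' (tendsto_nhds_unique hy'l hy)
  -- two points are comparable if the differences of their constants converge; each class
  -- has a representative `b`, against which the constants are normalized
  let S : Setoid X :=
    { r := fun z z' => ∃ l, Tendsto (fun k => c z k - c z' k) atTop (𝓝 l)
      iseqv :=
        { refl := fun z => ⟨0, by simp⟩
          symm := fun {z z'} ⟨l, hl⟩ => ⟨-l, hl.neg.congr fun k => by ring⟩
          trans := fun {z z' z''} ⟨l, hl⟩ ⟨l', hl'⟩ =>
            ⟨l + l', (hl.add hl').congr fun k => by ring⟩ } }
  let b : X → X := fun z => (Quotient.mk S z).out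
  have hb : ∀ z, ∃ l, Tendsto (fun k => c z k - c (b z) k) atTop (𝓝 l) := fun z =>
    S.symm (Quotient.mk_out (s := S) z)
  choose l hl using hb
  let g : X → ℝ := fun x => u x (chartAt E x x) - l x
  have hloc : ∀ z, ∀ x ∈ U z, g x = u z (chartAt E z x) - l z := by
    intro z x hx
    have h1 := hlim z x x ⟨hx, hUz x⟩
    have hbe : b x = b z := congrArg Quotient.out (Quotient.sound (s := S) ⟨_, h1⟩)
    have h2 : Tendsto (fun k => c x k - c (b x) k) atTop
        (𝓝 (u x (chartAt E x x) - u z (chartAt E z x) + l z)) := by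
      refine (h1.add (hl z)).congr fun k => ?_
      rw [hbe]; ring
    have h3 := tendsto_nhds_unique (hl x) h2
    simp only [g, h3]
    ring
  have hgs : ContMDiff 𝓘(ℝ, E) 𝓘(ℝ, ℝ) ∞ g := by
    intro z
    have h1 : ContMDiffAt 𝓘(ℝ, E) 𝓘(ℝ, ℝ) ∞ (fun y => u z y - l z) (chartAt E z z) :=
      (((hu z).contDiffAt (isOpen_ball.mem_nhds (mem_ball_self (hr z)))).sub
        contDiffAt_const).contMDiffAt
    have h2 : ContMDiffAt 𝓘(ℝ, E) 𝓘(ℝ, E) ∞ (chartAt E z) z :=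
      (contMDiffOn_chart (I := 𝓘(ℝ, E)) (n := ∞) (x := z)).contMDiffAt
        ((chartAt E z).open_source.mem_nhds (mem_chart_source E z))
    refine (h1.comp z h2).congr_of_eventuallyEq ?_
    filter_upwards [(hUo z).mem_nhds (hUz z)] with x hx using hloc z x hx
  refine ⟨g, hgs, funext fun z => Form.ext_inChart z ?_⟩
  have hzt := mem_chart_target E z
  rw [hα z _ (mem_ball_self (hr z)), dFun_inChart hgs z hzt]
  congr 1
  have hev : g ∘ (chartAt E z).symm =ᶠ[𝓝 (chartAt E z z)] fun y => u z y - l z := by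
    filter_upwards [isOpen_ball.mem_nhds (mem_ball_self (hr z))] with y hy
    have hyt := hrt z hy
    have hyU : (chartAt E z).symm y ∈ U z :=
      ⟨(chartAt E z).map_target hyt, by rwa [mem_preimage, (chartAt E z).right_inv hyt]⟩
    rw [Function.comp_apply, hloc z _ hyU, (chartAt E z).right_inv hyt]
  rw [hev.fderiv_eq, fderiv_sub_const]

end Gluing

/-! ### Non-degeneracy -/

section Nondegeneracy

variable {E : Type*} [NormedAddCommGroup E] [NormedSpace ℂ E]
  {X : Type*} [TopologicalSpace X] [ChartedSpace E X]

/-- Forms in a class with `𝔫_X = 0` are, up to exact forms, admissible for constants `≤ 2⁻ᵏ`; the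
primitives of the exact parts then converge to minus a primitive of a representative. -/
theorem eq_zero_of_normClass_eq_zero [FiniteDimensional ℂ E] [IsManifold 𝓘(ℂ, E) ω X]
    {c : DeRhamH1 E X} (hc : normClass c = 0) : c = 0 := by
  have : IsManifold 𝓘(ℝ, E) ∞ X := isManifold_real
  have : FiniteDimensional ℝ E := FiniteDimensional.complexToReal E
  obtain ⟨α, rfl⟩ := Submodule.mkQ_surjective _ c
  have hk : ∀ k : ℕ, ∃ (f : X → ℝ) (t : ℝ), ContMDiff 𝓘(ℝ, E) 𝓘(ℝ, ℝ) ∞ f ∧ 0 < t ∧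
      t ≤ (1 / 2) ^ k ∧ ∀ (x : X) (e : TangentSpace 𝓘(ℝ, E) x),
        (α.1 + dFun f : Form E X 1 ℝ) x ![e] ^ 2 + (α.1 + dFun f : Form E X 1 ℝ) x ![J x e] ^ 2 ≤
          t * levi (α.1 + dFun f) x e := by
    intro k
    have hlt : normClass (deRhamClass α) < ENNReal.ofReal ((1 / 2) ^ k) := by
      rw [hc]; simp
    rw [normClass_mk] at hlt
    simp only [iInf_lt_iff, normForm_eq] at hlt
    obtain ⟨f, hf, t, ⟨ht, h⟩, htk⟩ := hlt
    exact ⟨f, t, hf, ht, ((ENNReal.ofReal_lt_ofReal_iff (by positivity)).1 htk).le, h⟩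
  choose f t hf ht ht2 h using hk
  let _ : MeasurableSpace E := borel E
  have : BorelSpace E := ⟨rfl⟩
  have hmem := mem_exactForms_of_local_ae_tendsto (μ := MeasureTheory.Measure.addHaar)
    (exists_local_ae_tendsto α.2.1 α.2.2 hf ht ht2 h)
  exact (Submodule.Quotient.mk_eq_zero _).2 hmem

end Nondegeneracy

end HolNorm

end

theorem mainTheorem4 {E : Type*} [NormedAddCommGroup E] [NormedSpace ℂ E] [FiniteDimensional ℂ E]
    {X : Type*} [TopologicalSpace X] [T2Space X] [SecondCountableTopology X] [ChartedSpace E X]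
    [IsManifold 𝓘(ℂ, E) ω X] :
    (∀ c : HolNorm.DeRhamH1 E X, HolNorm.normClass c = 0 ↔ c = 0) ∧
    (∀ (t : ℝ), 0 ≤ t → ∀ c : HolNorm.DeRhamH1 E X,
      HolNorm.normClass (t • c) = ENNReal.ofReal t * HolNorm.normClass c) ∧
    (∀ a b : HolNorm.DeRhamH1 E X,
      HolNorm.normClass (a + b) ≤ 2 * max (HolNorm.normClass a) (HolNorm.normClass b)) ∧
    (∀ {E' : Type*} [NormedAddCommGroup E'] [NormedSpace ℂ E'] [FiniteDimensional ℂ E']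
      {Y : Type*} [TopologicalSpace Y] [T2Space Y] [SecondCountableTopology Y] [ChartedSpace E' Y]
      [IsManifold 𝓘(ℂ, E') ω Y] (F : Y → X) (hF : ContMDiff 𝓘(ℂ, E') 𝓘(ℂ, E) ω F)
      (c : HolNorm.DeRhamH1 E X),
      HolNorm.normClass (HolNorm.holPullback F hF c) ≤ HolNorm.normClass c) :=
  ⟨fun _ => ⟨HolNorm.eq_zero_of_normClass_eq_zero, fun h => h ▸ HolNorm.normClass_zero⟩,
    fun _ ht c => HolNorm.normClass_smul ht c, HolNorm.normClass_add_le,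
    fun F hF c => HolNorm.normClass_holPullback_le F hF c⟩
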